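/- Let $\mathfrak g\subset\operatorname{End}\mathbb C^7$ be the simple complex Lie algebra of type $G_2$, realized as the Lie algebra of all $7\times 7$ matrices $$\begin{bmatrix}A&v&\frac1{\sqrt2}B(\varphi^t)\\ \varphi&0&-v^t\\ \frac1{\sqrt2}B(v)&-\varphi^t&-A^t\end{bmatrix},\qquad A\in\mathfrak{sl}_3,\quad v=(v_1,v_2,v_3)^{T}\in\mathbb C^3,\quad \varphi=[\varphi_1,\varphi_2,\varphi_3]\in(\mathbb C^3)^*,$$ where $v^t=[v_3,v_2,v_1]$, $\varphi^t$ is the column with entries $\varphi_3,\varphi_2,\varphi_1$, $(A^t)_{ij}=A_{4-j,4-i}$ and $$B(v)=\begin{bmatrix}v_2&-v_1&0\\-v_3&0&v_1\\0&v_3&-v_2\end{bmatrix}.$$ Equip $\mathfrak g$ with the invariant form $\langle X,Y\rangle=\frac16\operatorname{tr}XY$. Let $\widehat{\mathfrak g}=\mathfrak g[t,t^{-1}]\oplus\mathbb CK$ be the affine Kac--Moody algebra, with $K$ central and $$[X[r],Y[s]]=[X,Y][r+s]+r\,\delta_{r,-s}\langle X,Y\rangle K,\qquad X[r]=Xt^r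 .$$ Let $V(\mathfrak g)_{\rm cri}$ be the vacuum module at the critical level, that is, the quotient of $U(\widehat{\mathfrak g})$ by the left ideal generated by $K+12$ and $\mathfrak g[t]$. A Segal--Sugawara vector is an element $v\in V(\mathfrak g)_{\rm cri}$ with $\mathfrak g[t]\,v=0$. Let $X^1,\dots,X^{14}$ be a basis of $\mathfrak g$, let $X_1,\dots,X_{14}$ be the dual basis, $\langle X^i,X_j\rangle=\delta_{ij}$, and for $r\in\mathbb Z$ put $$G[r]=\sum_{i=1}^{14}X^i\otimes X_i[r]\in\operatorname{End}\mathbb C^7\otimes U(\widehat{\mathfrak g}),$$ regarded as a $7\times7$ matrix over $U(\widehat{\mathfrak g})$ (it does not depend on the choice of the basis). Let $\operatorname{tr}$ denote the matrix trace. Proposition. The (images in $V(\mathfrak g)_{\rm cri}$ of the) elements $$S_3=\operatorname{tr}G[-1]^3,\qquad S_4=\operatorname{tr}G[-1]^4+\operatorname{tr}G[-2]\,G[-1]^2,\qquad S_5=\operatorname{tr}G[-1]^5+\operatorname{tr}G[-2]\,G[-1]^3$$ are Segal--Sugawara vectors for $\mathfrak g$. -/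

import Mathlib

open scoped TensorProduct

noncomputable section

/-! ### The simple Lie algebra of type `G₂` as a Lie algebra of `7 × 7` matrices -/

/-- The complex number `1 / √2`. -/
def invSqrtTwo : ℂ := ((Real.sqrt 2 : ℝ) : ℂ)⁻¹

lemma invSqrtTwo_mul_self : invSqrtTwo * invSqrtTwo = 1 / 2 := by
  unfold invSqrtTwo
  rw [← mul_inv, ← Complex.ofReal_mul, Real.mul_self_sqrt (by norm_num)]
  norm_num

/-- The `3 × 3` matrix `B(w)` attached to a vector `w ∈ ℂ³`. -/
def matB (w : Fin 3 → ℂ) : Matrix (Fin 3) (Fin 3) ℂ :=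
  !![w 1, -w 0, 0; -w 2, 0, w 0; 0, w 2, -w 1]

/-- The antidiagonal transpose of a row or column vector of length `3`. -/
def revVec (w : Fin 3 → ℂ) : Fin 3 → ℂ := fun i => w i.rev

/-- The transpose with respect to the antidiagonal, `(Aᵗ)ᵢⱼ = A_{4-j,4-i}` (indices from `1`). -/
def antiTranspose (A : Matrix (Fin 3) (Fin 3) ℂ) : Matrix (Fin 3) (Fin 3) ℂ :=
  Matrix.of fun i j => A j.rev i.rev

/-- The `7 × 7` matrix of a triple `(v, A, φ)`, `v ∈ ℂ³`, `A ∈ 𝔤𝔩₃`, `φ ∈ (ℂ³)*`, written in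
blocks of sizes `3, 1, 3`:
```
  A              v      (1/√2) B(φᵗ)
  φ              0      -vᵗ
  (1/√2) B(v)   -φᵗ     -Aᵗ
```
-/
def g2Matrix (v : Fin 3 → ℂ) (A : Matrix (Fin 3) (Fin 3) ℂ) (φ : Fin 3 → ℂ) :
    Matrix (Fin 7) (Fin 7) ℂ :=
  let C := invSqrtTwo • matB (revVec φ)
  let D := invSqrtTwo • matB v
  let E := -antiTranspose A
  let x := -revVec v
  let y := -revVec φ
  !![A 0 0, A 0 1, A 0 2, v 0, C 0 0, C 0 1, C 0 2;
     A 1 0, A 1 1, A 1 2, v 1, C 1 0, C 1 1, C 1 2;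
     A 2 0, A 2 1, A 2 2, v 2, C 2 0, C 2 1, C 2 2;
     φ 0,   φ 1,   φ 2,   0,   x 0,   x 1,   x 2;
     D 0 0, D 0 1, D 0 2, y 0, E 0 0, E 0 1, E 0 2;
     D 1 0, D 1 1, D 1 2, y 1, E 1 0, E 1 1, E 1 2;
     D 2 0, D 2 1, D 2 2, y 2, E 2 0, E 2 1, E 2 2]

/-- The entries of `g2Matrix v A φ`, written out. -/
lemma g2Matrix_entries (v φ : Fin 3 → ℂ) (A : Matrix (Fin 3) (Fin 3) ℂ) :
    let X := g2Matrix v A φ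
    X 0 0 = A 0 0 ∧ X 0 1 = A 0 1 ∧ X 0 2 = A 0 2 ∧ X 0 3 = v 0 ∧
      X 0 4 = invSqrtTwo * φ 1 ∧ X 0 5 = -(invSqrtTwo * φ 2) ∧ X 0 6 = 0 ∧
    X 1 0 = A 1 0 ∧ X 1 1 = A 1 1 ∧ X 1 2 = A 1 2 ∧ X 1 3 = v 1 ∧
      X 1 4 = -(invSqrtTwo * φ 0) ∧ X 1 5 = 0 ∧ X 1 6 = invSqrtTwo * φ 2 ∧
    X 2 0 = A 2 0 ∧ X 2 1 = A 2 1 ∧ X 2 2 = A 2 2 ∧ X 2 3 = v 2 ∧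
      X 2 4 = 0 ∧ X 2 5 = invSqrtTwo * φ 0 ∧ X 2 6 = -(invSqrtTwo * φ 1) ∧
    X 3 0 = φ 0 ∧ X 3 1 = φ 1 ∧ X 3 2 = φ 2 ∧ X 3 3 = 0 ∧
      X 3 4 = -v 2 ∧ X 3 5 = -v 1 ∧ X 3 6 = -v 0 ∧
    X 4 0 = invSqrtTwo * v 1 ∧ X 4 1 = -(invSqrtTwo * v 0) ∧ X 4 2 = 0 ∧ X 4 3 = -φ 2 ∧
      X 4 4 = -A 2 2 ∧ X 4 5 = -A 1 2 ∧ X 4 6 = -A 0 2 ∧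
    X 5 0 = -(invSqrtTwo * v 2) ∧ X 5 1 = 0 ∧ X 5 2 = invSqrtTwo * v 0 ∧ X 5 3 = -φ 1 ∧
      X 5 4 = -A 2 1 ∧ X 5 5 = -A 1 1 ∧ X 5 6 = -A 0 1 ∧
    X 6 0 = 0 ∧ X 6 1 = invSqrtTwo * v 2 ∧ X 6 2 = -(invSqrtTwo * v 1) ∧ X 6 3 = -φ 0 ∧
      X 6 4 = -A 2 0 ∧ X 6 5 = -A 1 0 ∧ X 6 6 = -A 0 0 := by
  have h0 : (0 : Fin 3).rev = 2 := rfl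
  have h1 : (1 : Fin 3).rev = 1 := rfl
  have h2 : (2 : Fin 3).rev = 0 := rfl
  intro X
  refine ⟨?_, ?_, ?_, ?_, ?_, ?_, ?_, ?_, ?_, ?_, ?_, ?_, ?_, ?_, ?_, ?_, ?_, ?_, ?_, ?_, ?_, ?_, ?_,
    ?_, ?_, ?_, ?_, ?_, ?_, ?_, ?_, ?_, ?_, ?_, ?_, ?_, ?_, ?_, ?_, ?_, ?_, ?_, ?_, ?_, ?_, ?_, ?_,
    ?_, ?_⟩ <;>
  simp [X, g2Matrix, matB, revVec, antiTranspose, h0, h1, h2]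

lemma ext_seven {X Y : Matrix (Fin 7) (Fin 7) ℂ}
    (h : ∀ i, X i 0 = Y i 0 ∧ X i 1 = Y i 1 ∧ X i 2 = Y i 2 ∧ X i 3 = Y i 3 ∧ X i 4 = Y i 4 ∧
      X i 5 = Y i 5 ∧ X i 6 = Y i 6) : X = Y := by
  ext i j
  obtain ⟨h0, h1, h2, h3, h4, h5, h6⟩ := h i
  fin_cases j <;> assumption

lemma g2Matrix_add (v v' φ φ' : Fin 3 → ℂ) (A A' : Matrix (Fin 3) (Fin 3) ℂ) :
    g2Matrix (v + v') (A + A') (φ + φ') = g2Matrix v A φ + g2Matrix v' A' φ' := by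
  refine ext_seven fun i => ?_
  fin_cases i <;> simp [g2Matrix_entries, mul_add, add_comm]

lemma g2Matrix_smul (c : ℂ) (v φ : Fin 3 → ℂ) (A : Matrix (Fin 3) (Fin 3) ℂ) :
    g2Matrix (c • v) (c • A) (c • φ) = c • g2Matrix v A φ := by
  refine ext_seven fun i => ?_
  fin_cases i <;> simp [g2Matrix_entries, mul_left_comm]

section G2

attribute [local instance 100] LieRing.ofAssociativeRing

set_option maxHeartbeats 4000000 in
lemma g2Matrix_lie (v v' φ φ' : Fin 3 → ℂ) (A A' : Matrix (Fin 3) (Fin 3) ℂ)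
    (hA : A.trace = 0) (hA' : A'.trace = 0) :
    ∃ (u : Fin 3 → ℂ) (B : Matrix (Fin 3) (Fin 3) ℂ) (ψ : Fin 3 → ℂ),
      B.trace = 0 ∧ g2Matrix u B ψ = ⁅g2Matrix v A φ, g2Matrix v' A' φ'⁆ := by
  have h2 : A 2 2 = -A 0 0 - A 1 1 := by
    rw [Matrix.trace_fin_three] at hA; linear_combination hA
  have h2' : A' 2 2 = -A' 0 0 - A' 1 1 := by
    rw [Matrix.trace_fin_three] at hA'; linear_combination hA'
  obtain ⟨M, hM⟩ : ∃ M, M = ⁅g2Matrix v A φ, g2Matrix v' A' φ'⁆ := ⟨_, rfl⟩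
  have key : ∀ i j : Fin 7, M i j = ∑ k, g2Matrix v A φ i k * g2Matrix v' A' φ' k j
      - ∑ k, g2Matrix v' A' φ' i k * g2Matrix v A φ k j := fun i j => by
    rw [hM, LieRing.of_associative_ring_bracket, Matrix.sub_apply, Matrix.mul_apply,
      Matrix.mul_apply]
  simp only [Fin.sum_univ_seven] at key
  have hs : invSqrtTwo ^ 2 = 1 / 2 := by rw [sq, invSqrtTwo_mul_self]
  rw [← hM]
  clear hM hA hA'
  refine ⟨![M 0 3, M 1 3, M 2 3],
    !![M 0 0, M 0 1, M 0 2; M 1 0, M 1 1, M 1 2; M 2 0, M 2 1, M 2 2],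
    ![M 3 0, M 3 1, M 3 2], ?_, ?_⟩
  · rw [Matrix.trace_fin_three]
    simp [key, g2Matrix_entries, h2, h2']
    ring_nf
    simp only [hs]
    ring
  · refine ext_seven fun i => ?_
    fin_cases i <;> simp [g2Matrix_entries, key, h2, h2'] <;> and_intros <;>
      (try ring_nf) <;> (try simp only [hs]) <;> (try ring)

/-- The matrices `g2Matrix v A φ` with `A` traceless, as a vector space. -/
def g2Submodule : Submodule ℂ (Matrix (Fin 7) (Fin 7) ℂ) where
  carrier := {X | ∃ (v : Fin 3 → ℂ) (A : Matrix (Fin 3) (Fin 3) ℂ) (φ : Fin 3 → ℂ),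
    A.trace = 0 ∧ g2Matrix v A φ = X}
  zero_mem' := ⟨0, 0, 0, by simp, by simpa using g2Matrix_smul 0 0 0 0⟩
  add_mem' := by
    rintro _ _ ⟨v, A, φ, hA, rfl⟩ ⟨v', A', φ', hA', rfl⟩
    exact ⟨v + v', A + A', φ + φ', by simp [hA, hA'], g2Matrix_add ..⟩
  smul_mem' := by
    rintro c _ ⟨v, A, φ, hA, rfl⟩
    exact ⟨c • v, c • A, c • φ, by simp [hA], g2Matrix_smul ..⟩

/-- The simple complex Lie algebra `𝔤` of type `G₂`, with the commutator of matrices. -/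
def g2 : LieSubalgebra ℂ (Matrix (Fin 7) (Fin 7) ℂ) where
  toSubmodule := g2Submodule
  lie_mem' := by
    rintro _ _ ⟨v, A, φ, hA, rfl⟩ ⟨v', A', φ', hA', rfl⟩
    exact g2Matrix_lie v v' φ φ' A A' hA hA'


/-- The symmetric invariant bilinear form `⟨X, Y⟩ = (1/6) tr(XY)` on `𝔤`. -/
def g2Form : LinearMap.BilinForm ℂ g2 :=
  LinearMap.mk₂ ℂ (fun X Y => (1 / 6 : ℂ) * (X.1 * Y.1).trace)
    (fun _ _ _ => by simp [add_mul, mul_add])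
    (fun _ _ _ => by simp; ring)
    (fun _ _ _ => by simp [mul_add])
    (fun _ _ _ => by simp; ring)

lemma g2Form_apply (X Y : g2) : g2Form X Y = (1 / 6 : ℂ) * (X.1 * Y.1).trace := rfl

lemma g2Form_isSymm : g2Form.IsSymm :=
  ⟨fun X Y => by simp [g2Form_apply, Matrix.trace_mul_comm X.1 Y.1]⟩

lemma g2Form_lieInvariant : g2Form.lieInvariant g2 := by
  intro X Y Z
  simp only [g2Form_apply, LieSubalgebra.coe_bracket, LieRing.of_associative_ring_bracket,
    sub_mul, mul_sub, Matrix.trace_sub]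
  rw [Matrix.mul_assoc X.1 Y.1 Z.1, Matrix.trace_mul_comm X.1, Matrix.mul_assoc Y.1 Z.1 X.1,
    Matrix.mul_assoc Y.1 X.1 Z.1]
  ring

end G2

/-! ### The affine Kac–Moody algebra -/

/-- The loop algebra `𝔤[t, t⁻¹]`. -/
abbrev G2Loop : Type := LieAlgebra.loopAlgebra ℂ ℤ g2

/-- The 2-cocycle of `𝔤[t, t⁻¹]` with `(X tʳ, Y tˢ) ↦ r δ_{r,-s} ⟨X, Y⟩`. (The cocycle attached by
Mathlib to a form `Φ` is `(X tʳ, Y tˢ) ↦ s δ_{r,-s} Φ(X, Y)`, hence the sign.) -/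
def g2Cocycle : LieModule.Cohomology.twoCocycle ℂ G2Loop (TrivialLieModule ℂ G2Loop ℂ) :=
  (-1 : ℂ) • LieAlgebra.LoopAlgebra.twoCocycleOfBilinear ℂ ℤ g2 g2Form g2Form_lieInvariant g2Form_isSymm

/-- The affine Kac–Moody algebra `𝔤[t, t⁻¹] ⊕ ℂ K`, the central extension of the loop algebra
by the cocycle above. -/
abbrev AffineG2 : Type := LieAlgebra.ofTwoCocycle g2Cocycle

/-- The element `X[r] = X tʳ` of the affine algebra. -/
def affineMode (r : ℤ) (X : g2) : AffineG2 :=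
  LieAlgebra.ofProd g2Cocycle (AddMonoidAlgebra.single r 1 ⊗ₜ[ℂ] X, 0)

/-- The central element `K`. -/
def affineK : AffineG2 :=
  LieAlgebra.ofProd g2Cocycle (0, (TrivialLieModule.equiv ℂ G2Loop ℂ).symm 1)

lemma g2Cocycle_apply (r s : ℤ) (X Y : g2) :
    g2Cocycle.1.1 (AddMonoidAlgebra.single r 1 ⊗ₜ[ℂ] X) (AddMonoidAlgebra.single s 1 ⊗ₜ[ℂ] Y) =
      (if r = -s then (r : ℂ) * g2Form X Y else 0) •
        (TrivialLieModule.equiv ℂ G2Loop ℂ).symm 1 := by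
  have h : LieAlgebra.LoopAlgebra.residuePairing ℂ ℤ g2 g2Form
      (AddMonoidAlgebra.single r 1 ⊗ₜ[ℂ] X) (AddMonoidAlgebra.single s 1 ⊗ₜ[ℂ] Y) =
      -(if r = -s then (r : ℂ) * g2Form X Y else 0) := by
    rw [LieAlgebra.LoopAlgebra.residuePairing_apply_apply,
      LieAlgebra.LoopAlgebra.toFinsupp_single_tmul, LieAlgebra.LoopAlgebra.toFinsupp_single_tmul,
      Finsupp.sum_single_index (by simp)]
    by_cases hrs : r = -s
    · subst hrs
      simp
    · simp [hrs]
  rw [show g2Cocycle.1.1 (AddMonoidAlgebra.single r 1 ⊗ₜ[ℂ] X)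
    (AddMonoidAlgebra.single s 1 ⊗ₜ[ℂ] Y) = (-1 : ℂ) • (TrivialLieModule.equiv ℂ G2Loop ℂ).symm
      (LieAlgebra.LoopAlgebra.residuePairing ℂ ℤ g2 g2Form
        (AddMonoidAlgebra.single r 1 ⊗ₜ[ℂ] X) (AddMonoidAlgebra.single s 1 ⊗ₜ[ℂ] Y)) from rfl, h,
    ← map_smul, ← map_smul]
  refine congrArg _ ?_
  rw [smul_eq_mul, smul_eq_mul]
  ring

/-- The defining relations `[X[r], Y[s]] = [X, Y][r + s] + r δ_{r,-s} ⟨X, Y⟩ K`. -/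
lemma affineMode_lie (r s : ℤ) (X Y : g2) :
    ⁅affineMode r X, affineMode s Y⁆ =
      affineMode (r + s) ⁅X, Y⁆ + (if r = -s then (r : ℂ) * g2Form X Y else 0) • affineK := by
  rw [LieAlgebra.bracket_ofTwoCocycle, affineMode, affineMode, affineMode, affineK,
    ← LieAlgebra.of_smul, ← LieAlgebra.of_add]
  refine congrArg _ (Prod.ext ?_ ?_)
  · simp only [Equiv.symm_apply_apply, Prod.fst_add, Prod.smul_fst, smul_zero, add_zero,
      LieAlgebra.ExtendScalars.bracket_tmul, AddMonoidAlgebra.single_mul_single, mul_one]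
  · simp only [Equiv.symm_apply_apply, Prod.snd_add, Prod.smul_snd, zero_add, lie_zero, add_zero,
      sub_zero]
    exact g2Cocycle_apply r s X Y

/-- The element `K` is central. -/
lemma affineK_lie (x : AffineG2) : ⁅affineK, x⁆ = 0 := by
  rw [LieAlgebra.bracket_ofTwoCocycle, ← LieAlgebra.of_zero]
  refine congrArg _ (Prod.ext ?_ ?_)
  · simp [affineK]
  · simp [affineK, LieModule.IsTrivial.trivial]

/-! ### The vacuum module at the critical level and the Feigin–Frenkel center -/

/-- The universal enveloping algebra of the affine algebra. -/
abbrev UAffineG2 : Type := UniversalEnvelopingAlgebra ℂ AffineG2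

/-- The element `X[r]` of the universal enveloping algebra. -/
def uMode (r : ℤ) (X : g2) : UAffineG2 := UniversalEnvelopingAlgebra.ι ℂ (affineMode r X)

/-- The element `K` of the universal enveloping algebra. -/
def uK : UAffineG2 := UniversalEnvelopingAlgebra.ι ℂ affineK

/-- The left ideal of `U(ĝ)` generated by `K + 12` and by `𝔤[t]`, i.e. by all `X[r]` with `X ∈ 𝔤`
and `r ≥ 0`. With respect to the form `(1/6) tr(XY) = (1/24) Tr(ad X ad Y)`, the critical level
is `K = -12`. -/
def vacuumIdeal : Submodule UAffineG2 UAffineG2 :=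
  Submodule.span UAffineG2 ({uK + 12} ∪ {u | ∃ (r : ℕ) (X : g2), u = uMode r X})

/-- The vacuum module `V(𝔤)` at the critical level, a left module over `U(ĝ)`. As `K` is central,
this is also the quotient of `U(ĝ) / (K + 12)` by its left ideal generated by `𝔤[t]`. -/
abbrev CriticalVacuumModule : Type := UAffineG2 ⧸ vacuumIdeal

/-- The Feigin–Frenkel center: the subspace of all `v` in the vacuum module at the critical level
with `𝔤[t] v = 0`. Its elements are the Segal–Sugawara vectors. -/
def feiginFrenkelCenter : Submodule ℂ CriticalVacuumModule where
  carrier := {v | ∀ (r : ℕ) (X : g2), uMode r X • v = 0}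
  zero_mem' := fun _ _ => smul_zero _
  add_mem' := fun hv hw r X => by rw [smul_add, hv r X, hw r X, add_zero]
  smul_mem' := fun c v hv r X => by rw [smul_comm, hv r X, smul_zero]

/-- An element of `U(ĝ)`, in particular of its subalgebra `U(t⁻¹𝔤[t⁻¹])`, gives a Segal–Sugawara
vector if its image in the vacuum module at the critical level lies in the Feigin–Frenkel center. -/
def IsSegalSugawara (S : UAffineG2) : Prop :=
  (Submodule.Quotient.mk S : CriticalVacuumModule) ∈ feiginFrenkelCenter

/-! ### The matrices `G[r]` -/

/-- For a family `b = (Xⁱ)` and a family `d = (Xᵢ)` in `𝔤`, the element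
`G[r] = ∑ᵢ Xⁱ ⊗ Xᵢ[r]` of `End ℂ⁷ ⊗ U(ĝ)`, viewed as a `7 × 7` matrix over `U(ĝ)`. -/
def matG {ι : Type*} [Fintype ι] (b d : ι → g2) (r : ℤ) : Matrix (Fin 7) (Fin 7) UAffineG2 :=
  ∑ k, Matrix.of fun i j => (b k).1 i j • uMode r (d k)

end

/-! All three vectors are polynomials in the quadratic Sugawara vector and its derivatives. The Lie
algebra $G_2$ has no independent quartic invariant: on $\mathfrak g$ one has
$\operatorname{tr}X^4=\frac14(\operatorname{tr}X^2)^2$. Traces of words of odd length change sign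
when the word is reversed. Hence classically $\operatorname{tr}G^3$ and $\operatorname{tr}G^5$
vanish and $\operatorname{tr}G^4$ is a square; only the lower-order terms created by reordering
modes remain to be computed.

A trace of a product of matrices $G[r]$ is a sum over dual bases of a word of modes times a scalar
multilinear form (`modeSum` and its iterates). Scalar identities apply to the form while the modes
stay fixed, and exchanging two adjacent modes (`modeSum_swap`) costs a shorter word, whose form is
contracted with the Casimir tensor. These contractions are evaluated through the Fierz-type identity
`g2Proj_fierz`. All modes involved in the reductions are negative, so no central term appears.

Solving the resulting linear relations expresses $S_3$, $S_4$, $S_5$ through `traceTwo` and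
`tracePair`: see `traceThree_eq`, `traceFour_add_eq`, `traceFive_add_eq`. The quadratic vectors that
occur are, up to scalars and reordering, translation derivatives of $\operatorname{tr}G[-1]^2$. They
are checked directly to be annihilated by $\mathfrak g[t]$; here the level $-12$ cancels half of the
adjoint Casimir value $24$. Products are covered by `IsSegalSugawara.mul`. -/

/-! ### Invariants of the seven-dimensional representation. -/

lemma mem_g2_iff {X : Matrix (Fin 7) (Fin 7) ℂ} : X ∈ g2 ↔ ∃ (v : Fin 3 → ℂ)
    (A : Matrix (Fin 3) (Fin 3) ℂ) (φ : Fin 3 → ℂ), A.trace = 0 ∧ g2Matrix v A φ = X :=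
  Iff.rfl

lemma coe_lie_g2 (X Y : g2) : (⁅X, Y⁆ : g2).1 = X.1 * Y.1 - Y.1 * X.1 := rfl

lemma invSqrtTwo_sq : invSqrtTwo ^ 2 = 1 / 2 := by rw [sq, invSqrtTwo_mul_self]

lemma invSqrtTwo_pow_four : invSqrtTwo ^ 4 = 1 / 4 := by
  rw [show (4 : ℕ) = 2 * 2 from rfl, pow_mul, invSqrtTwo_sq]; norm_num

set_option maxHeartbeats 4000000 in
-- The nonzero weights of $\mathbb C^7$ are $\pm x,\pm y,\pm z$ with $x+y+z=0$, and then
-- $x^4+y^4+z^4=\frac12(x^2+y^2+z^2)^2$. The proof expands entries instead.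
lemma trace_pow_four_g2 (X : g2) :
    (X.1 * X.1 * X.1 * X.1).trace = 1 / 4 * (X.1 * X.1).trace ^ 2 := by
  obtain ⟨_, v, A, φ, hA, rfl⟩ := X
  have h2 : A 2 2 = -A 0 0 - A 1 1 := by
    rw [Matrix.trace_fin_three] at hA; linear_combination hA
  obtain ⟨N, hN⟩ : ∃ N, N = g2Matrix v A φ * g2Matrix v A φ := ⟨_, rfl⟩
  have key : ∀ i j, N i j = ∑ k, g2Matrix v A φ i k * g2Matrix v A φ k j := fun i j => by
    rw [hN, Matrix.mul_apply]
  simp only [Fin.sum_univ_seven] at key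
  simp only
  rw [Matrix.mul_assoc _ (g2Matrix v A φ) (g2Matrix v A φ), ← hN]
  clear hN hA
  simp only [Matrix.trace, Matrix.diag, Matrix.mul_apply, Fin.sum_univ_seven]
  simp only [key]
  simp only [g2Matrix_entries, h2]
  ring_nf
  simp only [invSqrtTwo_sq, invSqrtTwo_pow_four]
  ring

lemma invSqrtTwo_pow_three : invSqrtTwo ^ 3 = invSqrtTwo / 2 := by
  rw [pow_succ, invSqrtTwo_sq]; ring

/-- Six times the orthogonal projection of `7 × 7` matrices onto `𝔤` (for the trace form). -/
noncomputable def g2Proj (M : Matrix (Fin 7) (Fin 7) ℂ) : Matrix (Fin 7) (Fin 7) ℂ :=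
  let t := M 0 0 - M 6 6 + (M 1 1 - M 5 5) + (M 2 2 - M 4 4)
  g2Matrix
    ![2 * (M 0 3 - M 3 6 + invSqrtTwo * (M 5 2 - M 4 1)),
      2 * (M 1 3 - M 3 5 + invSqrtTwo * (M 4 0 - M 6 2)),
      2 * (M 2 3 - M 3 4 + invSqrtTwo * (M 6 1 - M 5 0))]
    !![3 * (M 0 0 - M 6 6) - t, 3 * (M 0 1 - M 5 6), 3 * (M 0 2 - M 4 6);
       3 * (M 1 0 - M 6 5), 3 * (M 1 1 - M 5 5) - t, 3 * (M 1 2 - M 4 5);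
       3 * (M 2 0 - M 6 4), 3 * (M 2 1 - M 5 4), 3 * (M 2 2 - M 4 4) - t]
    ![2 * (M 3 0 - M 6 3 + invSqrtTwo * (M 2 5 - M 1 4)),
      2 * (M 3 1 - M 5 3 + invSqrtTwo * (M 0 4 - M 2 6)),
      2 * (M 3 2 - M 4 3 + invSqrtTwo * (M 1 6 - M 0 5))]

lemma g2Proj_mem (M : Matrix (Fin 7) (Fin 7) ℂ) : g2Proj M ∈ g2 := by
  refine mem_g2_iff.2 ⟨_, _, _, ?_, rfl⟩
  simp [Matrix.trace_fin_three]
  ring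

set_option maxHeartbeats 4000000 in
lemma trace_g2Proj_mul (M : Matrix (Fin 7) (Fin 7) ℂ) (X : g2) :
    (g2Proj M * X.1).trace = 6 * (M * X.1).trace := by
  obtain ⟨_, v, A, φ, hA, rfl⟩ := X
  have h2 : A 2 2 = -A 0 0 - A 1 1 := by
    rw [Matrix.trace_fin_three] at hA; linear_combination hA
  simp only [Matrix.trace, Matrix.diag, Matrix.mul_apply, Fin.sum_univ_seven, g2Proj]
  simp [g2Matrix_entries, h2]
  ring_nf
  simp only [invSqrtTwo_sq, invSqrtTwo_pow_three]
  ring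

set_option maxHeartbeats 4000000 in
lemma g2Proj_coe (X : g2) : g2Proj X.1 = 6 • X.1 := by
  obtain ⟨_, v, A, φ, hA, rfl⟩ := X
  have h2 : A 2 2 = -A 0 0 - A 1 1 := by
    rw [Matrix.trace_fin_three] at hA; linear_combination hA
  refine ext_seven fun i => ?_
  fin_cases i <;> simp [g2Proj, g2Matrix_entries, h2] <;> and_intros <;>
    (try ring_nf) <;> (try simp only [invSqrtTwo_sq,
      invSqrtTwo_pow_three]) <;> (try ring)

/-- The transpose with respect to the antidiagonal. -/
def revTranspose (M : Matrix (Fin 7) (Fin 7) ℂ) : Matrix (Fin 7) (Fin 7) ℂ :=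
  Matrix.of fun i j => M j.rev i.rev

lemma revTranspose_coe (X : g2) : revTranspose X.1 = -X.1 := by
  obtain ⟨_, v, A, φ, hA, rfl⟩ := X
  refine ext_seven fun i => ?_
  fin_cases i <;> simp [revTranspose, g2Matrix_entries, Fin.rev]

set_option maxHeartbeats 4000000 in
-- The left side is an entry of the contraction of the Casimir tensor around $M$. Such a contraction
-- is a $\mathfrak g$-equivariant map of $\operatorname{End}\mathbb C^7$, a sum of four distinct
-- irreducibles of dimensions 1, 7, 14, 27, so it is a combination of $M$, its antitranspose, its
-- trace and its projection to $\mathfrak g$. The coefficients are confirmed entrywise.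
lemma g2Proj_fierz (M : Matrix (Fin 7) (Fin 7) ℂ) (p s : Fin 7) :
    ∑ q, (M * g2Proj (Matrix.single q p 1)) q s =
      ((2 : ℂ) • M - (4 : ℂ) • revTranspose M + (2 * M.trace) • 1 - g2Proj M) p s := by
  fin_cases p <;> fin_cases s <;>
    simp [Matrix.mul_apply, Fin.sum_univ_seven, g2Proj, revTranspose, Matrix.trace,
      g2Matrix_entries, Matrix.single_apply, Fin.rev] <;>
    ring_nf <;> (try simp only [invSqrtTwo_sq]) <;> (try ring)

/-! ### Contractions with the Casimir tensor. -/

section DualBases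

variable {ι : Type*} [Fintype ι] [DecidableEq ι] {b : Module.Basis ι ℂ g2} {d : ι → g2}

lemma g2Form_comm (X Y : g2) : g2Form X Y = g2Form Y X := by
  simp [g2Form_apply, Matrix.trace_mul_comm X.1 Y.1]

lemma g2Form_lie_left (X Y Z : g2) : g2Form ⁅X, Y⁆ Z = g2Form X ⁅Y, Z⁆ := by
  simp only [g2Form_apply, coe_lie_g2, sub_mul, mul_sub, Matrix.trace_sub]
  rw [Matrix.mul_assoc X.1 Y.1 Z.1, Matrix.mul_assoc Y.1 X.1, Matrix.trace_mul_comm Y.1,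
    Matrix.mul_assoc X.1 Z.1]

/-- Pairing with the projection of a matrix unit reads off an entry of $Y$. -/
lemma eq_zero_of_g2Form {Y : g2} (h : ∀ X, g2Form X Y = 0) : Y = 0 := by
  ext p q
  have h1 := h ⟨g2Proj (Matrix.single q p 1), g2Proj_mem _⟩
  rw [g2Form_apply, trace_g2Proj_mul, Matrix.trace_single_mul] at h1
  simpa using h1

lemma sum_g2Form_smul_left (hd : ∀ i j, g2Form (b i) (d j) = if i = j then 1 else 0) (X : g2) :
    ∑ i, g2Form X (d i) • b i = X := by
  conv_rhs => rw [← b.sum_repr X]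
  refine Finset.sum_congr rfl fun i _ => ?_
  have h : g2Form X (d i) = b.repr X i := by
    conv_lhs => rw [← b.sum_repr X]
    simp only [map_sum, LinearMap.sum_apply, map_smul, LinearMap.smul_apply, hd]
    simp
  rw [h]

lemma sum_g2Form_smul_right (hd : ∀ i j, g2Form (b i) (d j) = if i = j then 1 else 0) (X : g2) :
    ∑ i, g2Form X (b i) • d i = X := by
  refine sub_eq_zero.1 (eq_zero_of_g2Form fun Y => ?_)
  rw [← sum_g2Form_smul_left hd Y]
  simp [map_sum, hd, g2Form_comm X]

/-- The factor six in `g2Proj` cancels the $\frac16$ of the form, so this is the expansion of a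
projected matrix unit in the family `d`. -/
lemma sum_apply_smul (hd : ∀ i j, g2Form (b i) (d j) = if i = j then 1 else 0) (p q : Fin 7) :
    ∑ i, (b i).1 p q • (d i).1 = g2Proj (Matrix.single q p 1) := by
  have h := congrArg Subtype.val (sum_g2Form_smul_right hd
    ⟨g2Proj (Matrix.single q p 1), g2Proj_mem _⟩)
  refine Eq.trans ?_ h
  simp [g2Form_apply, trace_g2Proj_mul, Matrix.trace_single_mul]

/-- The tensor `∑ b i ⊗ d i` is symmetric. -/
lemma sum_dual_swap (hd : ∀ i j, g2Form (b i) (d j) = if i = j then 1 else 0)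
    {M : Type*} [AddCommGroup M] [Module ℂ M] {f : g2 → g2 → M}
    (h1 : ∀ Y, IsLinearMap ℂ fun X => f X Y) (h2 : ∀ X, IsLinearMap ℂ (f X)) :
    ∑ i, f (d i) (b i) = ∑ i, f (b i) (d i) := by
  calc _ = ∑ i, ∑ j, g2Form (d i) (d j) • f (b j) (b i) := by
        refine Finset.sum_congr rfl fun i _ => ?_
        conv_lhs => rw [← sum_g2Form_smul_left hd (d i)]
        exact (map_sum (h1 (b i)).mk' _ _).trans (Finset.sum_congr rfl fun j _ => (h1 _).2 _ _)
    _ = ∑ j, ∑ i, g2Form (d j) (d i) • f (b j) (b i) := by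
        rw [Finset.sum_comm]
        simp_rw [g2Form_comm]
    _ = _ := by
        refine Finset.sum_congr rfl fun j _ => ?_
        conv_rhs => rw [← sum_g2Form_smul_left hd (d j)]
        exact ((map_sum (h2 (b j)).mk' _ _).trans
          (Finset.sum_congr rfl fun i _ => (h2 _).2 _ _)).symm

/-- The tensor `∑ b i ⊗ d i` is invariant. -/
lemma sum_dual_lie (hd : ∀ i j, g2Form (b i) (d j) = if i = j then 1 else 0)
    {M : Type*} [AddCommGroup M] [Module ℂ M] {f : g2 → g2 → M}
    (h1 : ∀ Y, IsLinearMap ℂ fun X => f X Y) (h2 : ∀ X, IsLinearMap ℂ (f X)) (X : g2) :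
    ∑ i, f ⁅X, b i⁆ (d i) = -∑ i, f (b i) ⁅X, d i⁆ := by
  calc _ = ∑ i, ∑ j, g2Form ⁅X, b i⁆ (d j) • f (b j) (d i) := by
        refine Finset.sum_congr rfl fun i _ => ?_
        conv_lhs => rw [← sum_g2Form_smul_left hd ⁅X, b i⁆]
        exact (map_sum (h1 (d i)).mk' _ _).trans (Finset.sum_congr rfl fun j _ => (h1 _).2 _ _)
    _ = ∑ j, ∑ i, (-g2Form ⁅X, d j⁆ (b i)) • f (b j) (d i) := by
        rw [Finset.sum_comm]
        refine Finset.sum_congr rfl fun j _ => Finset.sum_congr rfl fun i _ => ?_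
        rw [← lie_skew, map_neg, LinearMap.neg_apply, g2Form_lie_left, g2Form_comm]
    _ = _ := by
        rw [← Finset.sum_neg_distrib]
        refine Finset.sum_congr rfl fun j _ => ?_
        conv_rhs => rw [← sum_g2Form_smul_right hd ⁅X, d j⁆]
        simp only [neg_smul, Finset.sum_neg_distrib]
        exact congrArg _ ((map_sum (h2 (b j)).mk' _ _).trans
          (Finset.sum_congr rfl fun i _ => (h2 _).2 _ _)).symm

lemma sum_mul_mul (hd : ∀ i j, g2Form (b i) (d j) = if i = j then 1 else 0)
    (M : Matrix (Fin 7) (Fin 7) ℂ) :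
    ∑ i, (b i).1 * M * (d i).1 =
      (2 : ℂ) • M - (4 : ℂ) • revTranspose M + (2 * M.trace) • 1 - g2Proj M := by
  ext p s
  rw [← g2Proj_fierz]
  simp_rw [← sum_apply_smul hd, Matrix.mul_sum, Matrix.sum_apply]
  rw [Finset.sum_comm]
  refine Finset.sum_congr rfl fun i _ => ?_
  rw [Matrix.mul_assoc, Matrix.mul_apply]
  simp

lemma revTranspose_mul (M N : Matrix (Fin 7) (Fin 7) ℂ) :
    revTranspose (M * N) = revTranspose N * revTranspose M := by
  ext i j
  simp only [revTranspose, Matrix.of_apply, Matrix.mul_apply]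
  rw [← Equiv.sum_comp Fin.revPerm]
  simp [mul_comm]

lemma trace_revTranspose (M : Matrix (Fin 7) (Fin 7) ℂ) : (revTranspose M).trace = M.trace := by
  simp only [Matrix.trace, Matrix.diag, revTranspose, Matrix.of_apply]
  exact Equiv.sum_comp Fin.revPerm fun i => M i i

lemma trace_coe_g2 (X : g2) : X.1.trace = 0 := by
  have h := trace_revTranspose X.1
  rw [revTranspose_coe, Matrix.trace_neg] at h
  linear_combination (-1 / 2 : ℂ) * h

/-- Elements of $\mathfrak g$ are antisymmetric for the antidiagonal transpose, hence orthogonal to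
symmetric matrices. -/
lemma g2Proj_eq_zero {M : Matrix (Fin 7) (Fin 7) ℂ} (h : revTranspose M = M) : g2Proj M = 0 := by
  have h1 : ∀ i j, M i j = M j.rev i.rev := fun i j => (congrFun (congrFun h i) j).symm
  have e : g2Proj M = g2Matrix 0 0 0 := by
    simp only [g2Proj]
    congr 1
    · ext i; fin_cases i <;> simp [h1 0 3, h1 1 3, h1 2 3, h1 5 2, h1 4 0, h1 6 1, Fin.rev]
    · ext i j; fin_cases i <;> fin_cases j <;> simp [h1 0 0, h1 0 1, h1 0 2, h1 1 0, h1 1 1, h1 1 2, h1 2 0, h1 2 1, h1 2 2, Fin.rev]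
    · ext i; fin_cases i <;> simp [h1 3 0, h1 3 1, h1 3 2, h1 2 5, h1 0 4, h1 1 6, Fin.rev]
  rw [e]
  simpa using g2Matrix_smul 0 0 0 0

lemma sum_mul (hd : ∀ i j, g2Form (b i) (d j) = if i = j then 1 else 0) :
    ∑ i, (b i).1 * (d i).1 = (12 : ℂ) • 1 := by
  have h1 : revTranspose 1 = 1 := by
    ext i j
    simp [revTranspose, Matrix.one_apply, eq_comm]
  have h := sum_mul_mul hd 1
  simp only [mul_one, h1, g2Proj_eq_zero h1, Matrix.trace_one, Fintype.card_fin] at h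
  rw [h]
  module

/-- On $\mathfrak g$ the four terms of the Fierz identity give $2+4+0-6=0$. -/
lemma sum_mul_coe_mul (hd : ∀ i j, g2Form (b i) (d j) = if i = j then 1 else 0) (X : g2) :
    ∑ i, (b i).1 * X.1 * (d i).1 = 0 := by
  rw [sum_mul_mul hd, revTranspose_coe, g2Proj_coe, trace_coe_g2]
  module

/-- Split $XY$ into half the commutator, which lies in $\mathfrak g$ and contributes nothing, and
half the anticommutator, which is symmetric and has zero projection. -/
lemma sum_mul_coe_mul_coe_mul (hd : ∀ i j, g2Form (b i) (d j) = if i = j then 1 else 0)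
    (X Y : g2) : ∑ i, (b i).1 * (X.1 * Y.1) * (d i).1 =
      (2 * (X.1 * Y.1).trace) • 1 - (X.1 * Y.1 + Y.1 * X.1) := by
  have h1 := sum_mul_coe_mul hd ⁅X, Y⁆
  have h2 : revTranspose (X.1 * Y.1 + Y.1 * X.1) = X.1 * Y.1 + Y.1 * X.1 := by
    have : ∀ M N, revTranspose (M + N) = revTranspose M + revTranspose N := fun _ _ => rfl
    rw [this, revTranspose_mul, revTranspose_mul, revTranspose_coe, revTranspose_coe, neg_mul_neg,
      neg_mul_neg, add_comm]
  have h3 := sum_mul_mul hd (X.1 * Y.1 + Y.1 * X.1)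
  rw [h2, g2Proj_eq_zero h2, Matrix.trace_add, Matrix.trace_mul_comm Y.1] at h3
  simp only [coe_lie_g2, mul_sub, sub_mul, mul_add, add_mul, Finset.sum_sub_distrib,
    Finset.sum_add_distrib] at h1 h3
  have h4 : (2 : ℂ) • ∑ i, (b i).1 * (X.1 * Y.1) * (d i).1 = (2 : ℂ) •
    ((2 * (X.1 * Y.1).trace) • 1 - (X.1 * Y.1 + Y.1 * X.1)) := by
    rw [two_smul]
    nth_rw 2 [sub_eq_zero.1 h1]
    rw [h3]
    module
  exact smul_right_injective _ two_ne_zero h4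

/-- Contraction of a commutator in the matrix product. -/
lemma sum_mul_lie (hd : ∀ i j, g2Form (b i) (d j) = if i = j then 1 else 0) (Z : g2) :
    ∑ i, (b i).1 * (⁅Z, d i⁆ : g2).1 = (-12 : ℂ) • Z.1 := by
  have h1 := sum_mul_coe_mul hd Z
  have h2 := congrArg (· * Z.1) (sum_mul hd)
  simp only [Finset.sum_mul, smul_mul_assoc, one_mul] at h2
  simp only [coe_lie_g2, mul_sub, Finset.sum_sub_distrib, ← Matrix.mul_assoc, h1, h2]
  module

lemma sum_mul_coe_mul_lie (hd : ∀ i j, g2Form (b i) (d j) = if i = j then 1 else 0) (X Z : g2) :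
    ∑ i, (b i).1 * X.1 * (⁅Z, d i⁆ : g2).1 =
      (2 * (X.1 * Z.1).trace) • 1 - (X.1 * Z.1 + Z.1 * X.1) := by
  have h1 := sum_mul_coe_mul_coe_mul hd X Z
  have h2 := congrArg (· * Z.1) (sum_mul_coe_mul hd X)
  simp only [Finset.sum_mul, zero_mul] at h2
  simp only [coe_lie_g2, mul_sub, Finset.sum_sub_distrib, ← Matrix.mul_assoc, h2, sub_zero]
  rw [← h1]
  simp only [Matrix.mul_assoc]

lemma sum_trace_smul (hd : ∀ i j, g2Form (b i) (d j) = if i = j then 1 else 0) (X : g2) :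
    ∑ i, (X.1 * (b i).1).trace • d i = (6 : ℂ) • X := by
  conv_rhs => rw [← sum_g2Form_smul_right hd X]
  simp [Finset.smul_sum, smul_smul, g2Form_apply]

/-- The Casimir element acts on the adjoint representation by `24`. -/
lemma sum_lie_lie (hd : ∀ i j, g2Form (b i) (d j) = if i = j then 1 else 0) (X : g2) :
    ∑ i, ⁅⁅X, b i⁆, d i⁆ = (24 : ℂ) • X := by
  have hs : ∑ i, (d i).1 * (b i).1 = (12 : ℂ) • 1 := (sum_dual_swap hd
    (f := fun Y Z => Y.1 * Z.1) (fun _ => ⟨fun _ _ => by simp [add_mul], fun _ _ => by simp⟩)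
    (fun _ => ⟨fun _ _ => by simp [mul_add], fun _ _ => by simp⟩)).trans (sum_mul hd)
  have hz : ∑ i, (d i).1 * X.1 * (b i).1 = 0 := (sum_dual_swap hd
    (f := fun Y Z => Y.1 * X.1 * Z.1) (fun _ => ⟨fun _ _ => by simp [add_mul], fun _ _ => by simp⟩)
    (fun _ => ⟨fun _ _ => by simp [mul_add], fun _ _ => by simp⟩)).trans (sum_mul_coe_mul hd X)
  have e : ∀ i, (⁅⁅X, b i⁆, d i⁆ : g2).1 = X.1 * ((b i).1 * (d i).1) - (b i).1 * X.1 * (d i).1 -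
      (d i).1 * X.1 * (b i).1 + (d i).1 * (b i).1 * X.1 := fun i => by
    simp only [coe_lie_g2]; noncomm_ring
  refine Subtype.ext ?_
  rw [AddSubmonoidClass.coe_finsetSum]
  simp only [e, Finset.sum_add_distrib, Finset.sum_sub_distrib, ← Finset.mul_sum, ← Finset.sum_mul,
    sum_mul hd, sum_mul_coe_mul hd, hs, hz, mul_smul_comm, smul_mul_assoc, one_mul, mul_one]
  change _ = (24 : ℂ) • X.1
  module

end DualBases

/-! ### Reversal of words and polarization of the quartic identity. -/

section Polarization

lemma trace_cycle (X Y Z W : Matrix (Fin 7) (Fin 7) ℂ) :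
    (X * Y * Z * W).trace = (W * X * Y * Z).trace := by
  rw [Matrix.trace_mul_comm, ← Matrix.mul_assoc, ← Matrix.mul_assoc]

lemma trace_mul_reverse (X Y : g2) : (Y.1 * X.1).trace = (X.1 * Y.1).trace :=
  Matrix.trace_mul_comm _ _

/-- The antidiagonal transpose reverses products, preserves traces and is $-1$ on $\mathfrak g$, so
reversing a word of length $n$ multiplies its trace by $(-1)^n$. -/
lemma trace_mul_mul_reverse (X Y Z : g2) :
    (Z.1 * Y.1 * X.1).trace = -(X.1 * Y.1 * Z.1).trace := by
  rw [← trace_revTranspose (X.1 * Y.1 * Z.1)]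
  simp [revTranspose_mul, revTranspose_coe, Matrix.mul_assoc]

lemma trace_mul_mul_mul_reverse (X Y Z W : g2) :
    (W.1 * Z.1 * Y.1 * X.1).trace = (X.1 * Y.1 * Z.1 * W.1).trace := by
  rw [← trace_revTranspose (X.1 * Y.1 * Z.1 * W.1)]
  simp [revTranspose_mul, revTranspose_coe, Matrix.mul_assoc]

lemma trace_mul_mul_mul_mul_reverse (X Y Z W V : g2) :
    (V.1 * W.1 * Z.1 * Y.1 * X.1).trace = -(X.1 * Y.1 * Z.1 * W.1 * V.1).trace := by
  rw [← trace_revTranspose (X.1 * Y.1 * Z.1 * W.1 * V.1)]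
  simp [revTranspose_mul, revTranspose_coe, Matrix.mul_assoc]

lemma trace_cube_mul (X Y : g2) :
    (X.1 * X.1 * X.1 * Y.1).trace = 1 / 4 * (X.1 * X.1).trace * (X.1 * Y.1).trace := by
  have h (c : ℂ) := trace_pow_four_g2 (X + c • Y)
  have e (c : ℂ) : (X + c • Y).1 = X.1 + c • Y.1 := rfl
  simp only [e, add_mul, mul_add, Matrix.trace_add, Matrix.smul_mul, Matrix.mul_smul,
    Matrix.trace_smul, smul_eq_mul] at h
  have c1 := trace_cycle X.1 X.1 X.1 Y.1
  have c2 := trace_cycle Y.1 X.1 X.1 X.1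
  have c3 := trace_cycle X.1 Y.1 X.1 X.1
  have s := trace_mul_reverse X Y
  rw [s] at h
  -- The linear coefficient in `c` of a quartic polynomial $f$ is
  -- $\frac23(f(1)-f(-1))-\frac1{12}(f(2)-f(-2))$; it equals four times the wanted trace on the
  -- left, whence the quarter of these weights.
  linear_combination (1 / 6) * (h 1 - h (-1)) - (1 / 48) * (h 2 - h (-2)) + (3 / 4) * c1 +
    (1 / 2) * c2 + (1 / 4) * c3

/-- The polarized form of `tr X⁴ = (tr X²)² / 4` on `𝔤`. -/
lemma trace_mul_mul_mul_add (X Y Z W : g2) :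
    (X.1 * Y.1 * Z.1 * W.1).trace + (X.1 * Y.1 * W.1 * Z.1).trace +
      (X.1 * Z.1 * Y.1 * W.1).trace =
    1 / 4 * ((X.1 * Y.1).trace * (Z.1 * W.1).trace + (X.1 * Z.1).trace * (Y.1 * W.1).trace +
      (X.1 * W.1).trace * (Y.1 * Z.1).trace) := by
  have h1 := trace_cube_mul Y X
  have h2 := trace_cube_mul Z X
  have h3 := trace_cube_mul W X
  have h12 := trace_cube_mul (Y + Z) X
  have h13 := trace_cube_mul (Y + W) X
  have h23 := trace_cube_mul (Z + W) X
  have h123 := trace_cube_mul (Y + Z + W) X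
  have e (Y Z : g2) : (Y + Z).1 = Y.1 + Z.1 := rfl
  simp only [e, add_mul, mul_add, Matrix.trace_add] at h12 h13 h23 h123
  have r (Y Z W : g2) : (Y.1 * Z.1 * W.1 * X.1).trace = (X.1 * Y.1 * Z.1 * W.1).trace :=
    trace_cycle _ _ _ _
  have t (Y Z W : g2) : (X.1 * Y.1 * Z.1 * W.1).trace = (X.1 * W.1 * Z.1 * Y.1).trace := by
    rw [← trace_mul_mul_mul_reverse X W Z Y, r]
  simp only [r] at *
  rw [trace_mul_reverse X Y] at *
  rw [trace_mul_reverse X Z] at *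
  rw [trace_mul_reverse X W] at *
  rw [trace_mul_reverse Y Z] at *
  rw [trace_mul_reverse Y W] at *
  rw [trace_mul_reverse Z W] at *
  -- Inclusion–exclusion leaves the six orderings of $Y,Z,W$ after $X$; reversal identifies them in
  -- pairs.
  linear_combination (1 / 2) * (h123 - h12 - h13 - h23 + h1 + h2 + h3) +
    (1 / 2) * (t Y Z W + t Y W Z + t Z Y W)

end Polarization

/-! ### Modes in the enveloping algebra and sums over dual bases. -/

section Modes

attribute [local instance 100] LieRing.ofAssociativeRing

lemma affineMode_add (r : ℤ) (X Y : g2) :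
    affineMode r (X + Y) = affineMode r X + affineMode r Y := by
  rw [affineMode, affineMode, affineMode, ← LieAlgebra.of_add, TensorProduct.tmul_add,
    Prod.mk_add_mk, add_zero]

lemma affineMode_smul (r : ℤ) (c : ℂ) (X : g2) : affineMode r (c • X) = c • affineMode r X := by
  rw [affineMode, affineMode, ← LieAlgebra.of_smul, TensorProduct.tmul_smul, Prod.smul_mk,
    smul_zero]

/-- The map `X ↦ X[r]`, as a linear map. -/
noncomputable def uModeLinear (r : ℤ) : g2 →ₗ[ℂ] UAffineG2 where
  toFun := uMode r
  map_add' X Y := by rw [uMode, affineMode_add, map_add]; rfl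
  map_smul' c X := by rw [uMode, affineMode_smul, map_smul]; rfl

lemma uMode_add (r : ℤ) (X Y : g2) : uMode r (X + Y) = uMode r X + uMode r Y :=
  map_add (uModeLinear r) X Y

lemma uMode_smul (r : ℤ) (c : ℂ) (X : g2) : uMode r (c • X) = c • uMode r X :=
  map_smul (uModeLinear r) c X

lemma uMode_sum {ι : Type*} (s : Finset ι) (r : ℤ) (f : ι → g2) :
    uMode r (∑ i ∈ s, f i) = ∑ i ∈ s, uMode r (f i) := map_sum (uModeLinear r) f s

lemma uMode_mul (r s : ℤ) (X Y : g2) :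
    uMode r X * uMode s Y = uMode s Y * uMode r X + uMode (r + s) ⁅X, Y⁆ +
      (if r = -s then (r : ℂ) * g2Form X Y else 0) • uK := by
  have h := congrArg (UniversalEnvelopingAlgebra.ι ℂ) (affineMode_lie r s X Y)
  rw [LieHom.map_lie, LieRing.of_associative_ring_bracket, map_add, map_smul] at h
  rw [add_assoc]
  exact sub_eq_iff_eq_add'.1 h

lemma uMode_mul_of_ne {r s : ℤ} (hrs : r + s ≠ 0) (X Y : g2) :
    uMode r X * uMode s Y = uMode s Y * uMode r X + uMode (r + s) ⁅X, Y⁆ := by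
  rw [uMode_mul, if_neg (fun h => hrs (by omega)), zero_smul, add_zero]

lemma uK_mul_uMode (r : ℤ) (X : g2) : uK * uMode r X = uMode r X * uK := by
  have h := congrArg (UniversalEnvelopingAlgebra.ι ℂ) (affineK_lie (affineMode r X))
  rw [LieHom.map_lie, LieRing.of_associative_ring_bracket, map_zero] at h
  exact sub_eq_zero.1 h

variable {ι : Type*} [Fintype ι]

/-- The sum `∑ Xᵢ[r] ψ(Xⁱ)`. -/
noncomputable def modeSum (b d : ι → g2) (r : ℤ) (ψ : g2 → UAffineG2) : UAffineG2 :=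
  ∑ i, uMode r (d i) * ψ (b i)

/-- The sum of all `Xᵢ[r] Xⱼ[s] φ(Xⁱ, Xʲ)`. -/
noncomputable def modeSumTwo (b d : ι → g2) (r s : ℤ) (φ : g2 → g2 → ℂ) : UAffineG2 :=
  modeSum b d r fun X => modeSum b d s fun Y => algebraMap ℂ _ (φ X Y)

/-- The sum of all `Xᵢ[r] Xⱼ[s] Xₖ[t] φ(Xⁱ, Xʲ, Xᵏ)`. -/
noncomputable def modeSumThree (b d : ι → g2) (r s t : ℤ) (φ : g2 → g2 → g2 → ℂ) : UAffineG2 :=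
  modeSum b d r fun X => modeSumTwo b d s t (φ X)

/-- The analogue of `modeSumThree` for forms in four arguments. -/
noncomputable def modeSumFour (b d : ι → g2) (r s t u : ℤ) (φ : g2 → g2 → g2 → g2 → ℂ) :
    UAffineG2 :=
  modeSum b d r fun X => modeSumThree b d s t u (φ X)

/-- The analogue of `modeSumThree` for forms in five arguments. -/
noncomputable def modeSumFive (b d : ι → g2) (r s t u v : ℤ)
    (φ : g2 → g2 → g2 → g2 → g2 → ℂ) : UAffineG2 :=
  modeSum b d r fun X => modeSumFour b d s t u v (φ X)

variable (b d : ι → g2)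

lemma modeSum_add (r : ℤ) (ψ ψ' : g2 → UAffineG2) :
    modeSum b d r (fun X => ψ X + ψ' X) = modeSum b d r ψ + modeSum b d r ψ' := by
  simp [modeSum, mul_add, Finset.sum_add_distrib]

lemma modeSum_mul (r : ℤ) (ψ : g2 → UAffineG2) (u : UAffineG2) :
    modeSum b d r ψ * u = modeSum b d r fun X => ψ X * u := by
  simp [modeSum, Finset.sum_mul, mul_assoc]

lemma modeSum_smul (r : ℤ) (c : ℂ) (ψ : g2 → UAffineG2) :
    modeSum b d r (fun X => c • ψ X) = c • modeSum b d r ψ := by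
  simp [modeSum, Finset.smul_sum]

lemma modeSum_sum {κ : Type*} (s : Finset κ) (r : ℤ) (ψ : κ → g2 → UAffineG2) :
    modeSum b d r (fun X => ∑ k ∈ s, ψ k X) = ∑ k ∈ s, modeSum b d r (ψ k) := by
  simp only [modeSum, Finset.mul_sum]
  exact Finset.sum_comm

lemma isLinearMap_modeSum (r : ℤ) {ψ : g2 → g2 → UAffineG2}
    (h : ∀ X, IsLinearMap ℂ fun Y => ψ Y X) : IsLinearMap ℂ fun Y => modeSum b d r (ψ Y) where
  map_add Y Z := by
    rw [← modeSum_add]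
    exact congrArg _ (funext fun X => (h X).1 Y Z)
  map_smul c Y := by
    rw [← modeSum_smul]
    exact congrArg _ (funext fun X => (h X).2 c Y)

lemma isLinearMap_modeSumTwo (r s : ℤ) {φ : g2 → g2 → g2 → ℂ}
    (h : ∀ X Z, IsLinearMap ℂ fun Y => φ Y X Z) :
    IsLinearMap ℂ fun Y => modeSumTwo b d r s (φ Y) :=
  isLinearMap_modeSum b d r fun X => isLinearMap_modeSum b d s fun Z =>
    ⟨fun A B => by rw [(h X Z).1, map_add],
      fun c A => by rw [(h X Z).2, smul_eq_mul, map_mul, Algebra.smul_def]⟩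

lemma isLinearMap_modeSumThree (r s t : ℤ) {φ : g2 → g2 → g2 → g2 → ℂ}
    (h : ∀ X Z W, IsLinearMap ℂ fun Y => φ Y X Z W) :
    IsLinearMap ℂ fun Y => modeSumThree b d r s t (φ Y) :=
  isLinearMap_modeSum b d r fun X => isLinearMap_modeSumTwo b d s t fun Z W => h X Z W

lemma modeSumTwo_sum {κ : Type*} (S : Finset κ) (r s : ℤ) (φ : κ → g2 → g2 → ℂ) :
    modeSumTwo b d r s (fun X Y => ∑ k ∈ S, φ k X Y) = ∑ k ∈ S, modeSumTwo b d r s (φ k) := by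
  simp only [modeSumTwo, map_sum, modeSum_sum]

lemma modeSumThree_sum {κ : Type*} (S : Finset κ) (r s t : ℤ) (φ : κ → g2 → g2 → g2 → ℂ) :
    modeSumThree b d r s t (fun X Y Z => ∑ k ∈ S, φ k X Y Z) =
      ∑ k ∈ S, modeSumThree b d r s t (φ k) := by
  simp only [modeSumThree, modeSumTwo_sum, modeSum_sum]

lemma modeSumTwo_add (r s : ℤ) (φ φ' : g2 → g2 → ℂ) :
    modeSumTwo b d r s (fun X Y => φ X Y + φ' X Y) =
      modeSumTwo b d r s φ + modeSumTwo b d r s φ' := by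
  simp only [modeSumTwo, map_add, modeSum_add]

lemma modeSumThree_add (r s t : ℤ) (φ φ' : g2 → g2 → g2 → ℂ) :
    modeSumThree b d r s t (fun X Y Z => φ X Y Z + φ' X Y Z) =
      modeSumThree b d r s t φ + modeSumThree b d r s t φ' := by
  simp only [modeSumThree, modeSumTwo_add, modeSum_add]

lemma modeSumFour_add (r s t u : ℤ) (φ φ' : g2 → g2 → g2 → g2 → ℂ) :
    modeSumFour b d r s t u (fun X Y Z W => φ X Y Z W + φ' X Y Z W) =
      modeSumFour b d r s t u φ + modeSumFour b d r s t u φ' := by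
  simp only [modeSumFour, modeSumThree_add, modeSum_add]

lemma modeSumTwo_smul (r s : ℤ) (c : ℂ) (φ : g2 → g2 → ℂ) :
    modeSumTwo b d r s (fun X Y => c * φ X Y) = c • modeSumTwo b d r s φ := by
  simp only [modeSumTwo, map_mul, ← Algebra.smul_def, modeSum_smul]

lemma modeSumThree_smul (r s t : ℤ) (c : ℂ) (φ : g2 → g2 → g2 → ℂ) :
    modeSumThree b d r s t (fun X Y Z => c * φ X Y Z) = c • modeSumThree b d r s t φ := by
  simp only [modeSumThree, modeSumTwo_smul, modeSum_smul]

lemma modeSumFour_smul (r s t u : ℤ) (c : ℂ) (φ : g2 → g2 → g2 → g2 → ℂ) :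
    modeSumFour b d r s t u (fun X Y Z W => c * φ X Y Z W) = c • modeSumFour b d r s t u φ := by
  simp only [modeSumFour, modeSumThree_smul, modeSum_smul]

lemma modeSumFive_smul (r s t u v : ℤ) (c : ℂ) (φ : g2 → g2 → g2 → g2 → g2 → ℂ) :
    modeSumFive b d r s t u v (fun X Y Z W V => c * φ X Y Z W V) =
      c • modeSumFive b d r s t u v φ := by
  simp only [modeSumFive, modeSumFour_smul, modeSum_smul]

end Modes

/-! ### Exchanging adjacent modes. -/

section Swap

variable {ι : Type*} [Fintype ι] [DecidableEq ι] {b : Module.Basis ι ℂ g2} {d : ι → g2}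

/-- Exchange of two adjacent modes. -/
lemma modeSum_swap (hd : ∀ i j, g2Form (b i) (d j) = if i = j then 1 else 0) {r s : ℤ}
    (hrs : r + s ≠ 0) {ψ : g2 → g2 → UAffineG2} (h : ∀ X, IsLinearMap ℂ (ψ X)) :
    modeSum b d r (fun X => modeSum b d s fun Y => ψ X Y) =
      modeSum b d s (fun Y => modeSum b d r fun X => ψ X Y) +
        modeSum b d (r + s) fun Z => ∑ i, ψ (b i) ⁅Z, d i⁆ := by
  -- Invariance of the form moves the bracket from the modes to the arguments of `ψ`.
  have e : modeSum b d (r + s) (fun Z => ∑ i, ψ (b i) ⁅Z, d i⁆) =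
      ∑ i, ∑ j, uMode (r + s) ⁅d i, d j⁆ * ψ (b i) (b j) := by
    rw [modeSum_sum]
    refine Finset.sum_congr rfl fun i _ => ?_
    calc _ = ∑ m, ∑ j, g2Form ⁅b m, d i⁆ (d j) • (uMode (r + s) (d m) * ψ (b i) (b j)) := by
          refine Finset.sum_congr rfl fun m _ => ?_
          beta_reduce
          conv_lhs => rw [← sum_g2Form_smul_left hd ⁅b m, d i⁆]
          refine (congrArg _ (map_sum (h (b i)).mk' _ _)).trans ?_
          rw [Finset.mul_sum]
          refine Finset.sum_congr rfl fun j _ => ?_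
          rw [IsLinearMap.mk'_apply, (h (b i)).2, mul_smul_comm]
      _ = _ := by
          rw [Finset.sum_comm]
          refine Finset.sum_congr rfl fun j _ => ?_
          conv_rhs => rw [← sum_g2Form_smul_right hd ⁅d i, d j⁆, uMode_sum, Finset.sum_mul]
          refine Finset.sum_congr rfl fun m _ => ?_
          rw [uMode_smul, smul_mul_assoc, g2Form_lie_left, g2Form_comm]
  rw [e]
  simp only [modeSum, Finset.mul_sum]
  rw [Finset.sum_comm (f := fun i j => uMode s (d i) * (uMode r (d j) * ψ (b j) (b i))),
    ← Finset.sum_add_distrib]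
  refine Finset.sum_congr rfl fun i _ => ?_
  rw [← Finset.sum_add_distrib]
  refine Finset.sum_congr rfl fun j _ => ?_
  rw [← mul_assoc, uMode_mul_of_ne hrs, add_mul, mul_assoc]

lemma modeSumTwo_swap (hd : ∀ i j, g2Form (b i) (d j) = if i = j then 1 else 0) {r s : ℤ}
    (hrs : r + s ≠ 0) {φ : g2 → g2 → ℂ} (h : ∀ X, IsLinearMap ℂ (φ X)) :
    modeSumTwo b d r s φ = modeSumTwo b d s r (fun Y X => φ X Y) +
      modeSum b d (r + s) fun Z => algebraMap ℂ _ (∑ i, φ (b i) ⁅Z, d i⁆) := by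
  simp only [modeSumTwo, map_sum]
  exact modeSum_swap hd hrs fun X => ⟨fun A B => by rw [(h X).1, map_add],
      fun c A => by rw [(h X).2, smul_eq_mul, map_mul, Algebra.smul_def]⟩

lemma modeSumThree_swap_left (hd : ∀ i j, g2Form (b i) (d j) = if i = j then 1 else 0) {r s : ℤ}
    (t : ℤ) (hrs : r + s ≠ 0) {φ : g2 → g2 → g2 → ℂ}
    (h : ∀ X Z, IsLinearMap ℂ fun Y => φ X Y Z) :
    modeSumThree b d r s t φ = modeSumThree b d s r t (fun Y X Z => φ X Y Z) +
      modeSumTwo b d (r + s) t fun Z W => ∑ i, φ (b i) ⁅Z, d i⁆ W := by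
  simp only [modeSumThree, modeSumTwo, map_sum, modeSum_sum]
  rw [modeSum_swap hd hrs fun X => isLinearMap_modeSum b d t fun Z =>
    ⟨fun A B => by rw [(h X Z).1, map_add],
      fun c A => by rw [(h X Z).2, smul_eq_mul, map_mul, Algebra.smul_def]⟩, modeSum_sum]

lemma modeSumThree_swap_right (hd : ∀ i j, g2Form (b i) (d j) = if i = j then 1 else 0) (r : ℤ)
    {s t : ℤ} (hst : s + t ≠ 0) {φ : g2 → g2 → g2 → ℂ} (h : ∀ X Y, IsLinearMap ℂ (φ X Y)) :
    modeSumThree b d r s t φ = modeSumThree b d r t s (fun X Z Y => φ X Y Z) +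
      modeSumTwo b d r (s + t) fun X Z => ∑ i, φ X (b i) ⁅Z, d i⁆ := by
  simp only [modeSumThree]
  rw [modeSumTwo, ← modeSum_add]
  exact congrArg _ (funext fun X => modeSumTwo_swap hd hst (h X))

lemma modeSumFour_swap_left (hd : ∀ i j, g2Form (b i) (d j) = if i = j then 1 else 0) {r s : ℤ}
    (t u : ℤ) (hrs : r + s ≠ 0) {φ : g2 → g2 → g2 → g2 → ℂ}
    (h : ∀ X Z W, IsLinearMap ℂ fun Y => φ X Y Z W) :
    modeSumFour b d r s t u φ = modeSumFour b d s r t u (fun Y X Z W => φ X Y Z W) +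
      modeSumThree b d (r + s) t u fun Z W V => ∑ i, φ (b i) ⁅Z, d i⁆ W V := by
  simp only [modeSumFour, modeSumThree, modeSumTwo_sum, modeSum_sum]
  rw [modeSum_swap hd hrs fun X => isLinearMap_modeSumTwo b d t u fun Z W => h X Z W, modeSum_sum]

lemma modeSumFour_swap_middle (hd : ∀ i j, g2Form (b i) (d j) = if i = j then 1 else 0) (r : ℤ)
    {s t : ℤ} (u : ℤ) (hst : s + t ≠ 0) {φ : g2 → g2 → g2 → g2 → ℂ}
    (h : ∀ X Y W, IsLinearMap ℂ fun Z => φ X Y Z W) :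
    modeSumFour b d r s t u φ = modeSumFour b d r t s u (fun X Z Y W => φ X Y Z W) +
      modeSumThree b d r (s + t) u fun X Z W => ∑ i, φ X (b i) ⁅Z, d i⁆ W := by
  simp only [modeSumFour]
  rw [modeSumThree, ← modeSum_add]
  exact congrArg _ (funext fun X => modeSumThree_swap_left hd u hst (h X))

lemma modeSumFour_swap_right (hd : ∀ i j, g2Form (b i) (d j) = if i = j then 1 else 0) (r s : ℤ)
    {t u : ℤ} (htu : t + u ≠ 0) {φ : g2 → g2 → g2 → g2 → ℂ}
    (h : ∀ X Y Z, IsLinearMap ℂ (φ X Y Z)) :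
    modeSumFour b d r s t u φ = modeSumFour b d r s u t (fun X Y W Z => φ X Y Z W) +
      modeSumThree b d r s (t + u) fun X Y Z => ∑ i, φ X Y (b i) ⁅Z, d i⁆ := by
  simp only [modeSumFour]
  rw [modeSumThree, ← modeSum_add]
  exact congrArg _ (funext fun X => modeSumThree_swap_right hd s htu (h X))

lemma modeSumFive_swap_one_two (hd : ∀ i j, g2Form (b i) (d j) = if i = j then 1 else 0)
    {r s : ℤ} (t u v : ℤ) (hrs : r + s ≠ 0) {φ : g2 → g2 → g2 → g2 → g2 → ℂ}
    (h : ∀ X Z W V, IsLinearMap ℂ fun Y => φ X Y Z W V) :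
    modeSumFive b d r s t u v φ = modeSumFive b d s r t u v (fun Y X Z W V => φ X Y Z W V) +
      modeSumFour b d (r + s) t u v fun Z W V T => ∑ i, φ (b i) ⁅Z, d i⁆ W V T := by
  simp only [modeSumFive, modeSumFour, modeSumThree_sum, modeSum_sum]
  rw [modeSum_swap hd hrs fun X => isLinearMap_modeSumThree b d t u v fun Z W V => h X Z W V,
    modeSum_sum]

lemma modeSumFive_swap_two_three (hd : ∀ i j, g2Form (b i) (d j) = if i = j then 1 else 0)
    (r : ℤ) {s t : ℤ} (u v : ℤ) (hst : s + t ≠ 0) {φ : g2 → g2 → g2 → g2 → g2 → ℂ}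
    (h : ∀ X Y W V, IsLinearMap ℂ fun Z => φ X Y Z W V) :
    modeSumFive b d r s t u v φ = modeSumFive b d r t s u v (fun X Z Y W V => φ X Y Z W V) +
      modeSumFour b d r (s + t) u v fun X Z W V => ∑ i, φ X (b i) ⁅Z, d i⁆ W V := by
  simp only [modeSumFive]
  rw [modeSumFour, ← modeSum_add]
  exact congrArg _ (funext fun X => modeSumFour_swap_left hd u v hst (h X))

lemma modeSumFive_swap_four_five (hd : ∀ i j, g2Form (b i) (d j) = if i = j then 1 else 0)
    (r s t : ℤ) {u v : ℤ} (huv : u + v ≠ 0) {φ : g2 → g2 → g2 → g2 → g2 → ℂ}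
    (h : ∀ X Y Z W, IsLinearMap ℂ (φ X Y Z W)) :
    modeSumFive b d r s t u v φ = modeSumFive b d r s t v u (fun X Y Z V W => φ X Y Z W V) +
      modeSumFour b d r s t (u + v) fun X Y Z W => ∑ i, φ X Y Z (b i) ⁅W, d i⁆ := by
  simp only [modeSumFive]
  rw [modeSumFour, ← modeSum_add]
  exact congrArg _ (funext fun X => modeSumFour_swap_right hd s t huv (h X))

end Swap

/-! ### Traces of products of $G[r]$ as sums over modes. -/

section Traces

variable {ι : Type*} [Fintype ι] (b d : ι → g2)

lemma matG_mul_apply (r : ℤ) (N : Matrix (Fin 7) (Fin 7) UAffineG2) (p q : Fin 7) :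
    (matG b d r * N) p q =
      modeSum b d r fun X => ((X.1.map (algebraMap ℂ UAffineG2)) * N) p q := by
  simp only [matG, modeSum, Matrix.mul_apply, Matrix.sum_apply, Finset.sum_mul, Finset.mul_sum,
    Matrix.of_apply, Matrix.map_apply, Algebra.smul_def]
  rw [Finset.sum_comm]
  refine Finset.sum_congr rfl fun i _ => Finset.sum_congr rfl fun j _ => ?_
  rw [Algebra.commutes, mul_assoc]

/-- The trace of `C N`, for a matrix `C` of scalars. -/
lemma trace_mul_matG_mul (r : ℤ) (C : Matrix (Fin 7) (Fin 7) ℂ)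
    (N : Matrix (Fin 7) (Fin 7) UAffineG2) :
    (C.map (algebraMap ℂ UAffineG2) * (matG b d r * N)).trace =
      modeSum b d r fun X => ((C * X.1).map (algebraMap ℂ UAffineG2) * N).trace := by
  simp only [Matrix.trace, Matrix.diag, modeSum_sum, Matrix.map_mul, Matrix.mul_assoc]
  refine Finset.sum_congr rfl fun i _ => ?_
  simp only [Matrix.mul_apply (M := C.map (algebraMap ℂ UAffineG2)), modeSum_sum, matG_mul_apply,
    Matrix.map_apply, ← Algebra.smul_def, modeSum_smul]

lemma trace_matG_mul (r : ℤ) (N : Matrix (Fin 7) (Fin 7) UAffineG2) :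
    (matG b d r * N).trace =
      modeSum b d r fun X => (X.1.map (algebraMap ℂ UAffineG2) * N).trace := by
  simpa using trace_mul_matG_mul b d r 1 N

lemma trace_mul_matG (r : ℤ) (C : Matrix (Fin 7) (Fin 7) ℂ) :
    (C.map (algebraMap ℂ UAffineG2) * matG b d r).trace =
      modeSum b d r fun X => algebraMap ℂ _ (C * X.1).trace := by
  have h := trace_mul_matG_mul b d r C 1
  simp only [mul_one] at h
  rw [h]
  simp only [Matrix.trace, Matrix.diag, map_sum, Matrix.map_apply]

lemma trace_matG_two (r s : ℤ) : (matG b d r * matG b d s).trace =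
    modeSumTwo b d r s fun X Y => (X.1 * Y.1).trace := by
  simp only [trace_matG_mul, trace_mul_matG]; rfl

lemma trace_matG_three (r s t : ℤ) : (matG b d r * (matG b d s * matG b d t)).trace =
    modeSumThree b d r s t fun X Y Z => (X.1 * Y.1 * Z.1).trace := by
  simp only [trace_matG_mul, trace_mul_matG_mul, trace_mul_matG]; rfl

lemma trace_matG_four (r s t u : ℤ) :
    (matG b d r * (matG b d s * (matG b d t * matG b d u))).trace =
      modeSumFour b d r s t u fun X Y Z W => (X.1 * Y.1 * Z.1 * W.1).trace := by
  simp only [trace_matG_mul, trace_mul_matG_mul, trace_mul_matG]; rfl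

lemma trace_matG_five (r s t u v : ℤ) :
    (matG b d r * (matG b d s * (matG b d t * (matG b d u * matG b d v)))).trace =
      modeSumFive b d r s t u v fun X Y Z W V => (X.1 * Y.1 * Z.1 * W.1 * V.1).trace := by
  simp only [trace_matG_mul, trace_mul_matG_mul, trace_mul_matG]; rfl

lemma trace_matG_two_mul_trace_matG_two (r s t u : ℤ) :
    (matG b d r * matG b d s).trace * (matG b d t * matG b d u).trace =
      modeSumFour b d r s t u fun X Y Z W => (X.1 * Y.1).trace * (Z.1 * W.1).trace := by
  simp only [trace_matG_two, modeSumFour, modeSumThree, modeSumTwo_smul]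
  rw [modeSumTwo, modeSum_mul]
  simp only [modeSum_mul, Algebra.smul_def]

end Traces

/-! ### Linear relations between reordered traces. -/

section TraceRelations

lemma trace_mul_mul_swap (X Y Z : g2) :
    (X.1 * Y.1 * Z.1).trace = -(X.1 * Z.1 * Y.1).trace := by
  rw [← trace_mul_mul_reverse X Z Y, Matrix.mul_assoc X.1, Matrix.trace_mul_comm]

variable {ι : Type*} [Fintype ι]

/-- `tr G[r] G[s]` -/
noncomputable def traceTwo (b d : ι → g2) (r s : ℤ) : UAffineG2 :=
  modeSumTwo b d r s fun X Y => (X.1 * Y.1).trace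

/-- `tr G[r] G[s] G[t]` -/
noncomputable def traceThree (b d : ι → g2) (r s t : ℤ) : UAffineG2 :=
  modeSumThree b d r s t fun X Y Z => (X.1 * Y.1 * Z.1).trace

/-- `tr G[r] G[s] G[t] G[u]` -/
noncomputable def traceFour (b d : ι → g2) (r s t u : ℤ) : UAffineG2 :=
  modeSumFour b d r s t u fun X Y Z W => (X.1 * Y.1 * Z.1 * W.1).trace

/-- The variant of `traceFour` with the third and the fourth matrix exchanged in the trace. -/
noncomputable def traceFourRight (b d : ι → g2) (r s t u : ℤ) : UAffineG2 :=
  modeSumFour b d r s t u fun X Y Z W => (X.1 * Y.1 * W.1 * Z.1).trace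

/-- The variant of `traceFour` with the second and the third matrix exchanged in the trace. -/
noncomputable def traceFourMiddle (b d : ι → g2) (r s t u : ℤ) : UAffineG2 :=
  modeSumFour b d r s t u fun X Y Z W => (X.1 * Z.1 * Y.1 * W.1).trace

/-- `tr G[r] G[s] G[t] G[u] G[v]` -/
noncomputable def traceFive (b d : ι → g2) (r s t u v : ℤ) : UAffineG2 :=
  modeSumFive b d r s t u v fun X Y Z W V => (X.1 * Y.1 * Z.1 * W.1 * V.1).trace

/-- `tr G[r] G[s] · tr G[t] G[u]` -/
noncomputable def tracePair (b d : ι → g2) (r s t u : ℤ) : UAffineG2 :=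
  modeSumFour b d r s t u fun X Y Z W => (X.1 * Y.1).trace * (Z.1 * W.1).trace

/-- The variant of `tracePair` which pairs the first matrix with the third. -/
noncomputable def tracePairThird (b d : ι → g2) (r s t u : ℤ) : UAffineG2 :=
  modeSumFour b d r s t u fun X Y Z W => (X.1 * Z.1).trace * (Y.1 * W.1).trace

/-- The variant of `tracePair` which pairs the first matrix with the fourth. -/
noncomputable def tracePairFourth (b d : ι → g2) (r s t u : ℤ) : UAffineG2 :=
  modeSumFour b d r s t u fun X Y Z W => (X.1 * W.1).trace * (Y.1 * Z.1).trace

lemma tracePair_eq (b d : ι → g2) (r s t u : ℤ) :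
    tracePair b d r s t u = traceTwo b d r s * traceTwo b d t u := by
  rw [tracePair, ← trace_matG_two_mul_trace_matG_two, trace_matG_two, trace_matG_two]; rfl

/-- The polarized quartic identity for the matrices `G[r]`. -/
lemma traceFour_add_add (b d : ι → g2) (r s t u : ℤ) :
    traceFour b d r s t u + traceFourRight b d r s t u + traceFourMiddle b d r s t u =
      (1 / 4 : ℂ) • (tracePair b d r s t u + tracePairThird b d r s t u +
        tracePairFourth b d r s t u) := by
  simp only [traceFour, traceFourRight, traceFourMiddle, tracePair, tracePairThird,
    tracePairFourth, ← modeSumFour_add, ← modeSumFour_smul]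
  simp only [trace_mul_mul_mul_add]

variable [DecidableEq ι] {b : Module.Basis ι ℂ g2} {d : ι → g2}

lemma sum_trace_mul_lie_mul (hd : ∀ i j, g2Form (b i) (d j) = if i = j then 1 else 0)
    (P Q : Matrix (Fin 7) (Fin 7) ℂ) (Z : g2) :
    ∑ i, (P * (b i).1 * (⁅Z, d i⁆ : g2).1 * Q).trace = -12 * (P * Z.1 * Q).trace := by
  have h := congrArg (fun M => (P * M * Q).trace) (sum_mul_lie hd Z)
  simpa only [Finset.mul_sum, Finset.sum_mul, Matrix.trace_sum, mul_smul_comm, smul_mul_assoc,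
    Matrix.trace_smul, smul_eq_mul, ← Matrix.mul_assoc] using h

lemma sum_trace_mul_lie (hd : ∀ i j, g2Form (b i) (d j) = if i = j then 1 else 0)
    (P : Matrix (Fin 7) (Fin 7) ℂ) (Z : g2) :
    ∑ i, (P * (b i).1 * (⁅Z, d i⁆ : g2).1).trace = -12 * (P * Z.1).trace := by
  simpa using sum_trace_mul_lie_mul hd P 1 Z

lemma sum_trace_lie_mul (hd : ∀ i j, g2Form (b i) (d j) = if i = j then 1 else 0)
    (Q : Matrix (Fin 7) (Fin 7) ℂ) (Z : g2) :
    ∑ i, ((b i).1 * (⁅Z, d i⁆ : g2).1 * Q).trace = -12 * (Z.1 * Q).trace := by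
  simpa using sum_trace_mul_lie_mul hd 1 Q Z

/-- Here the contraction links two separate traces and merges them into one cubic trace, which is
how products of quadratic traces produce cubic corrections. -/
lemma sum_trace_mul_trace_lie (hd : ∀ i j, g2Form (b i) (d j) = if i = j then 1 else 0)
    (X Z W : g2) :
    ∑ i, (X.1 * (b i).1).trace * ((⁅Z, d i⁆ : g2).1 * W.1).trace =
      -12 * (X.1 * Z.1 * W.1).trace := by
  have h := congrArg (fun Y : g2 => ((⁅Z, Y⁆ : g2).1 * W.1).trace) (sum_trace_smul hd X)
  have e : ∀ Y : g2, ((⁅Z, Y⁆ : g2).1 * W.1).trace = (W.1 * Z.1 * Y.1).trace -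
      (Z.1 * W.1 * Y.1).trace := fun Y => by
    rw [coe_lie_g2, sub_mul, Matrix.trace_sub, Matrix.trace_mul_comm, ← Matrix.mul_assoc,
      Matrix.mul_assoc Y.1, Matrix.trace_mul_comm Y.1]
  simp only [e] at h ⊢
  simp only [AddSubmonoidClass.coe_finsetSum, Finset.mul_sum, Matrix.trace_sum] at h
  simp only [SetLike.val_smul, mul_smul_comm, Matrix.trace_smul, smul_eq_mul,
    ← Finset.sum_sub_distrib, ← mul_sub] at h
  rw [h, trace_mul_mul_reverse X Z W, Matrix.trace_mul_comm _ X.1, ← Matrix.mul_assoc]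
  ring

lemma traceTwo_comm (hd : ∀ i j, g2Form (b i) (d j) = if i = j then 1 else 0) {r s : ℤ}
    (h0 : r + s ≠ 0) : traceTwo b d r s = traceTwo b d s r := by
  rw [traceTwo, modeSumTwo_swap hd h0 fun X =>
    ⟨fun _ _ => by simp [mul_add], fun _ _ => by simp⟩]
  have e : ∀ Z, ∑ i, ((b i).1 * (⁅Z, d i⁆ : g2).1).trace = 0 := fun Z => by
    simpa only [one_mul, trace_coe_g2, mul_zero] using sum_trace_mul_lie hd 1 Z
  simp only [e, map_zero]
  simp [modeSum, traceTwo, fun X Y : g2 => Matrix.trace_mul_comm X.1 Y.1]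

lemma traceThree_swap_right (hd : ∀ i j, g2Form (b i) (d j) = if i = j then 1 else 0)
    {r s t m : ℤ} (hm : s + t = m) (h0 : m ≠ 0) :
    traceThree b d r s t = (-1 : ℂ) • traceThree b d r t s + (-12 : ℂ) • traceTwo b d r m := by
  subst hm
  rw [traceThree, modeSumThree_swap_right hd r h0 fun X Y =>
    ⟨fun _ _ => by simp [mul_add], fun _ _ => by simp⟩]
  simp only [traceThree, traceTwo, ← modeSumThree_smul, ← modeSumTwo_smul, sum_trace_mul_lie hd]
  congr! 5 with X Z Y
  rw [trace_mul_mul_swap]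
  ring

lemma traceThree_swap_left (hd : ∀ i j, g2Form (b i) (d j) = if i = j then 1 else 0)
    {r s t m : ℤ} (hm : r + s = m) (h0 : m ≠ 0) :
    traceThree b d r s t = (-1 : ℂ) • traceThree b d s r t + (-12 : ℂ) • traceTwo b d m t := by
  subst hm
  rw [traceThree, modeSumThree_swap_left hd t h0 fun X Y =>
    ⟨fun _ _ => by simp [mul_add, add_mul], fun _ _ => by simp⟩]
  simp only [traceThree, traceTwo, ← modeSumThree_smul, ← modeSumTwo_smul, sum_trace_lie_mul hd]
  congr! 5 with X Z Y
  rw [trace_mul_mul_swap, Matrix.trace_mul_comm, ← Matrix.mul_assoc]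
  ring

lemma traceFour_swap_right (hd : ∀ i j, g2Form (b i) (d j) = if i = j then 1 else 0)
    {r s t u m : ℤ} (hm : t + u = m) (h0 : m ≠ 0) :
    traceFour b d r s t u =
      traceFourRight b d r s u t + (-12 : ℂ) • traceThree b d r s m := by
  subst hm
  rw [traceFour, modeSumFour_swap_right hd r s h0 fun X Y Z =>
    ⟨fun _ _ => by simp [mul_add], fun _ _ => by simp⟩]
  simp only [traceFourRight, traceThree, ← modeSumThree_smul, sum_trace_mul_lie hd]

lemma traceFour_swap_middle (hd : ∀ i j, g2Form (b i) (d j) = if i = j then 1 else 0)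
    {r s t u m : ℤ} (hm : s + t = m) (h0 : m ≠ 0) :
    traceFour b d r s t u =
      traceFourMiddle b d r t s u + (-12 : ℂ) • traceThree b d r m u := by
  subst hm
  rw [traceFour, modeSumFour_swap_middle hd r u h0 fun X Y Z =>
    ⟨fun _ _ => by simp [mul_add, add_mul], fun _ _ => by simp⟩]
  simp only [traceFourMiddle, traceThree, ← modeSumThree_smul, sum_trace_mul_lie_mul hd]

lemma traceFour_swap_left (hd : ∀ i j, g2Form (b i) (d j) = if i = j then 1 else 0)
    {r s t u m : ℤ} (hm : r + s = m) (h0 : m ≠ 0) :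
    traceFour b d r s t u =
      traceFourRight b d s r t u + (-12 : ℂ) • traceThree b d m t u := by
  subst hm
  rw [traceFour, modeSumFour_swap_left hd t u h0 fun X Y Z =>
    ⟨fun _ _ => by simp [mul_add, add_mul], fun _ _ => by simp⟩]
  have e (Z W V : g2) : ∑ i, ((b i).1 * (⁅Z, d i⁆ : g2).1 * W.1 * V.1).trace =
      -12 * (Z.1 * W.1 * V.1).trace := by
    simpa only [Matrix.mul_assoc] using sum_trace_lie_mul hd (W.1 * V.1) Z
  simp only [traceFourRight, traceThree, ← modeSumThree_smul, e]
  congr! 6 with X Y Z W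
  rw [← trace_mul_mul_mul_reverse Y X Z W, ← trace_cycle, ← trace_cycle]

lemma tracePair_swap (hd : ∀ i j, g2Form (b i) (d j) = if i = j then 1 else 0)
    {r s t u m : ℤ} (hm : s + t = m) (h0 : m ≠ 0) :
    tracePair b d r s t u =
      tracePairThird b d r t s u + (-12 : ℂ) • traceThree b d r m u := by
  subst hm
  rw [tracePair, modeSumFour_swap_middle hd r u h0 fun X Y Z =>
    ⟨fun _ _ => by simp [mul_add, add_mul], fun _ _ => by simp [mul_left_comm]⟩]
  simp only [tracePairThird, traceThree, ← modeSumThree_smul, sum_trace_mul_trace_lie hd]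

lemma tracePairThird_swap (hd : ∀ i j, g2Form (b i) (d j) = if i = j then 1 else 0)
    {r s t u m : ℤ} (hm : t + u = m) (h0 : m ≠ 0) :
    tracePairThird b d r s t u =
      tracePairFourth b d r s u t + (12 : ℂ) • traceThree b d r s m := by
  subst hm
  rw [tracePairThird, modeSumFour_swap_right hd r s h0 fun X Y Z =>
    ⟨fun _ _ => by simp [mul_add], fun _ _ => by simp [mul_left_comm]⟩]
  have e (X Y Z : g2) : ∑ i, (X.1 * (b i).1).trace * (Y.1 * (⁅Z, d i⁆ : g2).1).trace =
      12 * (X.1 * Y.1 * Z.1).trace := by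
    simp only [fun i => Matrix.trace_mul_comm Y.1 (⁅Z, d i⁆ : g2).1]
    rw [sum_trace_mul_trace_lie hd, trace_mul_mul_swap]
    ring
  simp only [tracePairFourth, traceThree, ← modeSumThree_smul, e]

/-- Reversing a word of five gives a minus sign, so twice the trace consists of reordering
corrections only. -/
lemma two_smul_traceFive (hd : ∀ i j, g2Form (b i) (d j) = if i = j then 1 else 0) {r m : ℤ}
    (hm : r + r = m) (h0 : m ≠ 0) :
    (2 : ℂ) • traceFive b d r r r r r =
      (-12 : ℂ) • traceFour b d r r r m + (-12 : ℂ) • traceFourRight b d m r r r +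
      ((2 : ℂ) • tracePair b d r m r r + (-1 : ℂ) • traceFourRight b d r m r r +
        (-1 : ℂ) • traceFour b d r m r r) + (-12 : ℂ) • traceFour b d m r r r := by
  subst hm
  -- Reversing the first three and the last two factors is a full reversal up to rotation, so four
  -- adjacent exchanges suffice.
  have l1 := modeSumFive_swap_four_five hd r r r h0
    (φ := fun X Y Z W V => (X.1 * Y.1 * Z.1 * W.1 * V.1).trace) fun _ _ _ _ =>
    ⟨fun _ _ => by simp [mul_add], fun _ _ => by simp⟩
  have l2 := modeSumFive_swap_one_two hd r r r h0
    (φ := fun X Y Z W V => (X.1 * Y.1 * Z.1 * V.1 * W.1).trace) fun _ _ _ _ =>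
    ⟨fun _ _ => by simp [mul_add, add_mul], fun _ _ => by simp⟩
  have l3 := modeSumFive_swap_two_three hd r r r h0
    (φ := fun X Y Z W V => (Y.1 * X.1 * Z.1 * V.1 * W.1).trace) fun _ _ _ _ =>
    ⟨fun _ _ => by simp [mul_add, add_mul], fun _ _ => by simp⟩
  have l4 := modeSumFive_swap_one_two hd r r r h0
    (φ := fun X Y Z W V => (Z.1 * X.1 * Y.1 * V.1 * W.1).trace) fun _ _ _ _ =>
    ⟨fun _ _ => by simp [mul_add, add_mul], fun _ _ => by simp⟩
  have e2 (Z W V T : g2) : ∑ i, ((b i).1 * (⁅Z, d i⁆ : g2).1 * W.1 * T.1 * V.1).trace =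
      -12 * (Z.1 * W.1 * T.1 * V.1).trace := by
    simpa only [Matrix.mul_assoc] using sum_trace_lie_mul hd (W.1 * (T.1 * V.1)) Z
  -- In this exchange the contracted factors are separated by `X`, which produces the product of two
  -- traces.
  have e3 (X Z W V : g2) : ∑ i, ((b i).1 * X.1 * (⁅Z, d i⁆ : g2).1 * V.1 * W.1).trace =
      2 * ((X.1 * Z.1).trace * (W.1 * V.1).trace) + -1 * (X.1 * Z.1 * V.1 * W.1).trace +
        -1 * (X.1 * Z.1 * W.1 * V.1).trace := by
    have h := congrArg (fun M => (M * (V.1 * W.1)).trace) (sum_mul_coe_mul_lie hd X Z)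
    simp only [Finset.sum_mul, Matrix.trace_sum, sub_mul, add_mul, Matrix.trace_sub,
      Matrix.trace_add, smul_mul_assoc, one_mul, Matrix.trace_smul, smul_eq_mul,
      ← Matrix.mul_assoc] at h
    have h' : (Z.1 * X.1 * V.1 * W.1).trace = (X.1 * Z.1 * W.1 * V.1).trace := by
      rw [← trace_mul_mul_mul_reverse X Z W V, ← trace_cycle, ← trace_cycle]
    rw [h, h', trace_mul_reverse W V]
    ring
  have e4 (Z W V T : g2) : ∑ i, (W.1 * (b i).1 * (⁅Z, d i⁆ : g2).1 * T.1 * V.1).trace =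
      -12 * (Z.1 * W.1 * V.1 * T.1).trace := by
    rw [← trace_mul_mul_mul_reverse Z W V T, ← trace_cycle, ← trace_cycle]
    simpa only [Matrix.mul_assoc] using sum_trace_mul_lie_mul hd W.1 (T.1 * V.1) Z
  have e5 : (fun X Y Z W V : g2 => (Z.1 * Y.1 * X.1 * V.1 * W.1).trace) =
      fun X Y Z W V => -1 * (X.1 * Y.1 * Z.1 * W.1 * V.1).trace := by
    ext X Y Z W V
    rw [trace_mul_mul_mul_mul_reverse W V X Y Z, Matrix.mul_assoc (W.1 * V.1 * X.1),
      Matrix.mul_assoc (W.1 * V.1), Matrix.trace_mul_comm]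
    simp only [← Matrix.mul_assoc, neg_mul, one_mul]
  simp only [sum_trace_mul_lie hd] at l1
  simp only [e2] at l2
  simp only [e3] at l3
  simp only [e4] at l4
  rw [e5] at l4
  rw [l2, l3, l4] at l1
  simp only [modeSumFour_add, modeSumFour_smul, modeSumFive_smul] at l1
  simp only [traceFive, traceFour, traceFourRight, tracePair]
  rw [two_smul]
  nth_rw 1 [l1]
  module

end TraceRelations

/-! ### The vacuum module and closure of its invariants under products. -/

section Vacuum

/-- The projection onto the vacuum module. -/
noncomputable def vacuumMk : UAffineG2 →ₗ[UAffineG2] CriticalVacuumModule := vacuumIdeal.mkQ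

lemma vacuumMk_mul (u v : UAffineG2) : vacuumMk (u * v) = u • vacuumMk v :=
  vacuumMk.map_smul u v

lemma vacuumMk_smul (c : ℂ) (u : UAffineG2) : vacuumMk (c • u) = c • vacuumMk u := rfl

lemma vacuumMk_mul_uMode (u : UAffineG2) {r : ℤ} (hr : 0 ≤ r) (X : g2) :
    vacuumMk (u * uMode r X) = 0 := by
  obtain ⟨n, rfl⟩ := Int.eq_ofNat_of_zero_le hr
  exact (Submodule.Quotient.mk_eq_zero _).2
    (vacuumIdeal.smul_mem u (Submodule.subset_span (Or.inr ⟨n, X, rfl⟩)))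

lemma vacuumMk_mul_uK (u : UAffineG2) : vacuumMk (u * uK) = (-12 : ℂ) • vacuumMk u := by
  have h : vacuumMk (u * (uK + 12)) = 0 := (Submodule.Quotient.mk_eq_zero _).2
    (vacuumIdeal.smul_mem u (Submodule.subset_span (Or.inl rfl)))
  have h12 : u * 12 = (12 : ℂ) • u := by
    rw [Algebra.smul_def, map_ofNat]
    exact (Nat.cast_commute 12 u).symm.eq
  rw [mul_add, map_add, h12, vacuumMk_smul] at h
  rw [neg_smul]
  exact eq_neg_of_add_eq_zero_left h

lemma isSegalSugawara_iff {S : UAffineG2} :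
    IsSegalSugawara S ↔ ∀ (r : ℕ) (X : g2), vacuumMk (uMode r X * S) = 0 :=
  forall₂_congr fun r X => by rw [vacuumMk_mul]; rfl

lemma IsSegalSugawara.add {S T : UAffineG2} (hS : IsSegalSugawara S) (hT : IsSegalSugawara T) :
    IsSegalSugawara (S + T) :=
  feiginFrenkelCenter.add_mem hS hT

lemma IsSegalSugawara.smul {S : UAffineG2} (hS : IsSegalSugawara S) (c : ℂ) :
    IsSegalSugawara (c • S) :=
  feiginFrenkelCenter.smul_mem c hS

/-- Segal–Sugawara vectors form a subalgebra. -/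
lemma IsSegalSugawara.mul {S T : UAffineG2} (hS : IsSegalSugawara S) (hT : IsSegalSugawara T)
    (hK : Commute uK T) : IsSegalSugawara (S * T) := by
  -- Right multiplication by `T` preserves the left ideal, since it does so on the generators; thus
  -- it induces an endomorphism of the vacuum module.
  have key : ∀ u ∈ vacuumIdeal, u * T ∈ vacuumIdeal := fun u hu => by
    induction hu using Submodule.span_induction with
    | mem x hx =>
      rcases hx with rfl | ⟨r, X, rfl⟩
      · have h12 : (12 : UAffineG2) * T = T * 12 := (Nat.cast_commute 12 T).eq
        rw [add_mul, hK.eq, h12, ← mul_add]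
        exact vacuumIdeal.smul_mem T (Submodule.subset_span (Or.inl rfl))
      · exact (Submodule.Quotient.mk_eq_zero _).1 (isSegalSugawara_iff.1 hT r X)
    | zero => simp
    | add x y _ _ hx hy => rw [add_mul]; exact vacuumIdeal.add_mem hx hy
    | smul a x _ hx => rw [smul_eq_mul, mul_assoc]; exact vacuumIdeal.smul_mem a hx
  refine isSegalSugawara_iff.2 fun r X => ?_
  rw [← mul_assoc]
  exact (Submodule.Quotient.mk_eq_zero _).2
    (key _ ((Submodule.Quotient.mk_eq_zero _).1 (isSegalSugawara_iff.1 hS r X)))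

variable {ι : Type*} [Fintype ι] [DecidableEq ι] {b : Module.Basis ι ℂ g2} {d : ι → g2}

/-- The Lie algebra `𝔤[t]` is generated by `𝔤` and `𝔤 t`. -/
lemma isSegalSugawara_of_zero_one (hd : ∀ i j, g2Form (b i) (d j) = if i = j then 1 else 0)
    {S : UAffineG2} (h0 : ∀ X, vacuumMk (uMode 0 X * S) = 0)
    (h1 : ∀ X, vacuumMk (uMode 1 X * S) = 0) : IsSegalSugawara S := by
  refine isSegalSugawara_iff.2 fun r => ?_
  induction r with
  | zero => exact h0
  | succ n ih =>
    have hl : ∀ X Y, vacuumMk (uMode (n + 1) ⁅X, Y⁆ * S) = 0 := fun X Y => by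
      have e : uMode (n + 1) ⁅X, Y⁆ = uMode n X * uMode 1 Y - uMode 1 Y * uMode n X := by
        rw [uMode_mul_of_ne (by omega)]; abel
      rw [e, sub_mul, map_sub, mul_assoc, mul_assoc, vacuumMk_mul, h1,
        vacuumMk_mul (uMode 1 Y), ih, smul_zero, smul_zero, sub_zero]
    intro X
    -- The adjoint Casimir writes `24 • X` as a sum of brackets, to which `hl` applies.
    have h := congrArg (fun Y => vacuumMk (uMode (n + 1) Y * S)) (sum_lie_lie hd X)
    simp only [uMode_sum, Finset.sum_mul, map_sum, hl, Finset.sum_const_zero, uMode_smul,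
      smul_mul_assoc, vacuumMk_smul] at h
    push_cast
    exact ((smul_eq_zero_iff_right (by norm_num)).1 h.symm)

end Vacuum

/-! ### The quadratic Sugawara vector and its derivatives. -/

section Quadratic

variable {ι : Type*} [Fintype ι]

/-- The sum `∑ [X, Xⁱ][r] Xᵢ[s]`. -/
noncomputable def lieModeSum (b d : ι → g2) (X : g2) (r s : ℤ) : UAffineG2 :=
  ∑ i, uMode r ⁅X, b i⁆ * uMode s (d i)

lemma commute_uK_traceTwo (b d : ι → g2) (r s : ℤ) : Commute uK (traceTwo b d r s) :=
  Commute.sum_right _ _ _ fun _ _ => Commute.mul_right (uK_mul_uMode _ _)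
    (Commute.sum_right _ _ _ fun _ _ => Commute.mul_right (uK_mul_uMode _ _)
      (Algebra.commute_algebraMap_right _ _))

lemma vacuumMk_lieModeSum (b d : ι → g2) (X : g2) (r : ℤ) {s : ℤ} (hs : 0 ≤ s) :
    vacuumMk (lieModeSum b d X r s) = 0 := by
  simp [lieModeSum, vacuumMk_mul_uMode _ hs]

variable [DecidableEq ι] {b : Module.Basis ι ℂ g2} {d : ι → g2}

lemma isLinearMap_uMode_mul_left (r : ℤ) (u : UAffineG2) :
    IsLinearMap ℂ fun X => uMode r X * u :=
  ⟨fun _ _ => by rw [uMode_add, add_mul], fun _ _ => by rw [uMode_smul, smul_mul_assoc]⟩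

lemma isLinearMap_uMode_mul_right (r : ℤ) (u : UAffineG2) :
    IsLinearMap ℂ fun X => u * uMode r X :=
  ⟨fun _ _ => by rw [uMode_add, mul_add], fun _ _ => by rw [uMode_smul, mul_smul_comm]⟩

lemma traceTwo_eq_sum (hd : ∀ i j, g2Form (b i) (d j) = if i = j then 1 else 0) (r s : ℤ) :
    traceTwo b d r s = (6 : ℂ) • ∑ i, uMode r (b i) * uMode s (d i) := by
  rw [← sum_dual_swap hd (f := fun X Y => uMode r X * uMode s Y)
    (fun _ => isLinearMap_uMode_mul_left _ _) (fun _ => isLinearMap_uMode_mul_right _ _),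
    Finset.smul_sum]
  refine Finset.sum_congr rfl fun i _ => ?_
  rw [← mul_smul_comm, ← uMode_smul, ← sum_trace_smul hd, uMode_sum]
  refine congrArg (uMode r (d i) * ·) (Finset.sum_congr rfl fun j _ => ?_)
  rw [uMode_smul, Algebra.smul_def, Algebra.commutes]

lemma sum_uMode_mul_lie (hd : ∀ i j, g2Form (b i) (d j) = if i = j then 1 else 0) (X : g2)
    (r s : ℤ) : ∑ i, uMode r (b i) * uMode s ⁅X, d i⁆ = -lieModeSum b d X r s := by
  rw [lieModeSum, sum_dual_lie hd (f := fun X Y => uMode r X * uMode s Y)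
    (fun _ => isLinearMap_uMode_mul_left _ _) (fun _ => isLinearMap_uMode_mul_right _ _), neg_neg]

/-- By symmetry of the Casimir tensor the sum is a sum of commutators of modes, and these add up to
the adjoint Casimir. -/
lemma lieModeSum_add_swap (hd : ∀ i j, g2Form (b i) (d j) = if i = j then 1 else 0) (X : g2)
    {r s : ℤ} (hrs : r + s ≠ 0) :
    lieModeSum b d X r s + lieModeSum b d X s r = (24 : ℂ) • uMode (r + s) X := by
  have h : ∑ i, uMode s (d i) * uMode r ⁅X, b i⁆ = -lieModeSum b d X s r := by
    rw [← sum_uMode_mul_lie hd]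
    exact sum_dual_swap hd (f := fun Y Z => uMode s Y * uMode r ⁅X, Z⁆)
      (fun _ => isLinearMap_uMode_mul_left _ _)
      (fun _ => ⟨fun _ _ => by rw [lie_add, uMode_add, mul_add],
        fun _ _ => by rw [lie_smul, uMode_smul, mul_smul_comm]⟩)
  rw [← uMode_smul, ← sum_lie_lie hd, uMode_sum, ← sub_neg_eq_add, ← h, lieModeSum,
    ← Finset.sum_sub_distrib]
  refine Finset.sum_congr rfl fun i _ => ?_
  rw [uMode_mul_of_ne hrs]
  abel

/-- The action of `X[m]` on a quadratic vector. -/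
lemma vacuumMk_uMode_mul_traceTwo (hd : ∀ i j, g2Form (b i) (d j) = if i = j then 1 else 0)
    (X : g2) {m : ℤ} (hm : 0 ≤ m) (r s : ℤ) :
    vacuumMk (uMode m X * traceTwo b d r s) = (6 : ℂ) •
      (vacuumMk (lieModeSum b d X (m + r) s) - vacuumMk (lieModeSum b d X r (m + s)) -
        (if m = -r then 12 * (m : ℂ) else 0) • vacuumMk (uMode s X) -
        (if m = -s then 12 * (m : ℂ) else 0) • vacuumMk (uMode r X)) := by
  have e1 : uMode s X = ∑ i, g2Form X (b i) • uMode s (d i) := by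
    conv_lhs => rw [← sum_g2Form_smul_right hd X, uMode_sum]
    simp only [uMode_smul]
  have e2 : uMode r X = ∑ i, g2Form X (d i) • uMode r (b i) := by
    conv_lhs => rw [← sum_g2Form_smul_left hd X, uMode_sum]
    simp only [uMode_smul]
  rw [traceTwo_eq_sum hd, mul_smul_comm, vacuumMk_smul, ← neg_neg (lieModeSum b d X r (m + s)),
    ← sum_uMode_mul_lie hd, e1, e2, lieModeSum]
  simp only [Finset.mul_sum, map_sum, Finset.smul_sum, map_neg, sub_neg_eq_add,
    ← Finset.sum_add_distrib, ← Finset.sum_sub_distrib, vacuumMk_smul]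
  refine Finset.sum_congr rfl fun i _ => congrArg _ ?_
  -- `X[m]` is carried to the right until it kills the vacuum; each central term becomes the scalar
  -- $-12$.
  rw [← mul_assoc, uMode_mul m r, add_mul, add_mul, mul_assoc, uMode_mul m s, smul_mul_assoc,
    uK_mul_uMode]
  simp only [mul_add, map_add, vacuumMk_smul, mul_smul_comm, vacuumMk_mul_uK, ← mul_assoc,
    vacuumMk_mul_uMode _ hm]
  split_ifs <;> module

lemma vacuumMk_uMode_zero_mul_traceTwo
    (hd : ∀ i j, g2Form (b i) (d j) = if i = j then 1 else 0) (X : g2) (r s : ℤ) :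
    vacuumMk (uMode 0 X * traceTwo b d r s) = 0 := by
  rw [vacuumMk_uMode_mul_traceTwo hd X le_rfl]
  simp

lemma vacuumMk_lieModeSum_zero (hd : ∀ i j, g2Form (b i) (d j) = if i = j then 1 else 0)
    (X : g2) {s : ℤ} (hs : s ≠ 0) :
    vacuumMk (lieModeSum b d X 0 s) = (24 : ℂ) • vacuumMk (uMode s X) := by
  have h := congrArg vacuumMk (lieModeSum_add_swap hd X (r := 0) (s := s) (by omega))
  rwa [map_add, vacuumMk_lieModeSum b d X s le_rfl, add_zero, zero_add, vacuumMk_smul] at h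

/-- For $X[1]$ the Casimir contributes $24\,X[-1]$ and the two central terms $-12\,X[-1]$ each: the
cancellation that singles out the critical level. -/
lemma isSegalSugawara_traceTwo (hd : ∀ i j, g2Form (b i) (d j) = if i = j then 1 else 0) :
    IsSegalSugawara (traceTwo b d (-1) (-1)) := by
  refine isSegalSugawara_of_zero_one hd (vacuumMk_uMode_zero_mul_traceTwo hd · _ _) fun X => ?_
  have h1 := vacuumMk_lieModeSum_zero hd X (s := -1) (by norm_num)
  have h2 := vacuumMk_lieModeSum b d X (-1) le_rfl
  rw [vacuumMk_uMode_mul_traceTwo hd X zero_le_one]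
  norm_num
  rw [h1, h2]
  module

lemma isSegalSugawara_traceTwo_derivative
    (hd : ∀ i j, g2Form (b i) (d j) = if i = j then 1 else 0) :
    IsSegalSugawara (traceTwo b d (-1) (-2)) := by
  refine isSegalSugawara_of_zero_one hd (vacuumMk_uMode_zero_mul_traceTwo hd · _ _) fun X => ?_
  have h1 := vacuumMk_lieModeSum_zero hd X (s := -2) (by norm_num)
  have h2 := congrArg vacuumMk (lieModeSum_add_swap hd X (r := -1) (s := -1) (by norm_num))
  rw [map_add, vacuumMk_smul] at h2
  rw [vacuumMk_uMode_mul_traceTwo hd X zero_le_one]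
  norm_num at h2 ⊢
  rw [h1]
  linear_combination (norm := module) (-1 / 2 : ℂ) • h2

/-- The combination is the image of $\operatorname{tr}G[-1]G[-2]$ under the translation
$X[-r]\mapsto rX[-r-1]$. Translating once more gives, up to order and a factor $6$, the vector of
the next lemma. -/
lemma isSegalSugawara_traceTwo_second_derivative
    (hd : ∀ i j, g2Form (b i) (d j) = if i = j then 1 else 0) :
    IsSegalSugawara ((2 : ℂ) • traceTwo b d (-1) (-3) + traceTwo b d (-2) (-2)) := by
  refine isSegalSugawara_of_zero_one hd (fun X => ?_) fun X => ?_
  · rw [mul_add, map_add, mul_smul_comm, vacuumMk_smul, vacuumMk_uMode_zero_mul_traceTwo hd,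
      vacuumMk_uMode_zero_mul_traceTwo hd, smul_zero, add_zero]
  have h1 := vacuumMk_lieModeSum_zero hd X (s := -3) (by norm_num)
  have h2 := congrArg vacuumMk (lieModeSum_add_swap hd X (r := -1) (s := -2) (by norm_num))
  rw [map_add, vacuumMk_smul] at h2
  rw [mul_add, map_add, mul_smul_comm, vacuumMk_smul,
    vacuumMk_uMode_mul_traceTwo hd X zero_le_one, vacuumMk_uMode_mul_traceTwo hd X zero_le_one]
  norm_num at h2 ⊢
  rw [h1]
  linear_combination (norm := module) (-6 : ℂ) • h2

lemma isSegalSugawara_traceTwo_third_derivative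
    (hd : ∀ i j, g2Form (b i) (d j) = if i = j then 1 else 0) :
    IsSegalSugawara (traceTwo b d (-1) (-4) + traceTwo b d (-2) (-3)) := by
  refine isSegalSugawara_of_zero_one hd (fun X => ?_) fun X => ?_
  · rw [mul_add, map_add, vacuumMk_uMode_zero_mul_traceTwo hd,
      vacuumMk_uMode_zero_mul_traceTwo hd, add_zero]
  have h1 := vacuumMk_lieModeSum_zero hd X (s := -4) (by norm_num)
  have h2 := congrArg vacuumMk (lieModeSum_add_swap hd X (r := -2) (s := -2) (by norm_num))
  rw [map_add, vacuumMk_smul] at h2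
  rw [mul_add, map_add, vacuumMk_uMode_mul_traceTwo hd X zero_le_one,
    vacuumMk_uMode_mul_traceTwo hd X zero_le_one]
  norm_num at h2 ⊢
  rw [h1]
  linear_combination (norm := module) (-3 : ℂ) • h2

end Quadratic

/-! ### Reduction of the three vectors to quadratic ones. -/

section SegalSugawara

variable {ι : Type*} [Fintype ι] [DecidableEq ι] {b : Module.Basis ι ℂ g2} {d : ι → g2}

/-- Exchanging the last two equal modes returns the negative of the same trace, so only half of the
correction $-12$ survives. -/
lemma traceThree_eq (hd : ∀ i j, g2Form (b i) (d j) = if i = j then 1 else 0) :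
    traceThree b d (-1) (-1) (-1) = (-6 : ℂ) • traceTwo b d (-1) (-2) := by
  have h := traceThree_swap_right hd (r := -1) (s := -1) (t := -1) (m := -2) rfl (by norm_num)
  linear_combination (norm := module) (1 / 2 : ℂ) • h

/-- Up to cubic terms the three quartic words coincide, as do the three pairings, so the polarized
identity gives the square; the cubic terms then reduce to quadratic ones. -/
lemma traceFour_add_eq (hd : ∀ i j, g2Form (b i) (d j) = if i = j then 1 else 0) :
    traceFour b d (-1) (-1) (-1) (-1) + traceThree b d (-2) (-1) (-1) =
      (1 / 4 : ℂ) • tracePair b d (-1) (-1) (-1) (-1) +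
        (12 : ℂ) • ((2 : ℂ) • traceTwo b d (-1) (-3) + traceTwo b d (-2) (-2)) := by
  have c3r112 := traceThree_swap_right hd (r := -1) (s := -1) (t := -2) (m := -3) rfl (by norm_num)
  have c3l112 := traceThree_swap_left hd (r := -1) (s := -1) (t := -2) (m := -2) rfl (by norm_num)
  have c3r211 := traceThree_swap_right hd (r := -2) (s := -1) (t := -1) (m := -2) rfl (by norm_num)
  have fr1111 :=
    traceFour_swap_right hd (r := -1) (s := -1) (t := -1) (u := -1) (m := -2) rfl (by norm_num)
  have fm1111 :=
    traceFour_swap_middle hd (r := -1) (s := -1) (t := -1) (u := -1) (m := -2) rfl (by norm_num)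
  have fs1111 := traceFour_add_add b d (-1) (-1) (-1) (-1)
  have pm1111 :=
    tracePair_swap hd (r := -1) (s := -1) (t := -1) (u := -1) (m := -2) rfl (by norm_num)
  have pr1111 :=
    tracePairThird_swap hd (r := -1) (s := -1) (t := -1) (u := -1) (m := -2) rfl (by norm_num)
  -- The coefficients solve the linear system in which every trace of a given mode order is an
  -- independent unknown.
  linear_combination (norm := module) (-2 : ℂ) • c3r112 + (-3 / 2 : ℂ) • c3l112 +
    (1 / 2 : ℂ) • c3r211 + (1 / 3 : ℂ) • fr1111 + (1 / 3 : ℂ) • fm1111 + (1 / 3 : ℂ) • fs1111 +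
    (-1 / 6 : ℂ) • pm1111 + (-1 / 12 : ℂ) • pr1111

/-- At leading order, with $F$ the quartic trace containing one mode $-2$ and $P$ the corresponding
pair, the left side is $-18F+P$. Since $F=\frac14P$ at that order, it equals $-\frac72P$, which is
split as $-\frac12-3$ between the two orders of the factors. -/
lemma traceFive_add_eq (hd : ∀ i j, g2Form (b i) (d j) = if i = j then 1 else 0) :
    traceFive b d (-1) (-1) (-1) (-1) (-1) + traceFour b d (-2) (-1) (-1) (-1) =
      (-1 / 2 : ℂ) • tracePair b d (-1) (-2) (-1) (-1) +
        (-3 : ℂ) • tracePair b d (-1) (-1) (-2) (-1) +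
        (-144 : ℂ) • (traceTwo b d (-1) (-4) + traceTwo b d (-2) (-3)) := by
  have c3r113 := traceThree_swap_right hd (r := -1) (s := -1) (t := -3) (m := -4) rfl (by norm_num)
  have c3l113 := traceThree_swap_left hd (r := -1) (s := -1) (t := -3) (m := -2) rfl (by norm_num)
  have c3l131 := traceThree_swap_left hd (r := -1) (s := -3) (t := -1) (m := -4) rfl (by norm_num)
  have c3r311 := traceThree_swap_right hd (r := -3) (s := -1) (t := -1) (m := -2) rfl (by norm_num)
  have c3r122 := traceThree_swap_right hd (r := -1) (s := -2) (t := -2) (m := -4) rfl (by norm_num)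
  have c3l122 := traceThree_swap_left hd (r := -1) (s := -2) (t := -2) (m := -3) rfl (by norm_num)
  have c3r212 := traceThree_swap_right hd (r := -2) (s := -1) (t := -2) (m := -3) rfl (by norm_num)
  have c3l221 := traceThree_swap_left hd (r := -2) (s := -2) (t := -1) (m := -4) rfl (by norm_num)
  have fr1112 :=
    traceFour_swap_right hd (r := -1) (s := -1) (t := -1) (u := -2) (m := -3) rfl (by norm_num)
  have fm1112 :=
    traceFour_swap_middle hd (r := -1) (s := -1) (t := -1) (u := -2) (m := -2) rfl (by norm_num)
  have fl1112 :=
    traceFour_swap_left hd (r := -1) (s := -1) (t := -1) (u := -2) (m := -2) rfl (by norm_num)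
  have fs1112 := traceFour_add_add b d (-1) (-1) (-1) (-2)
  have pm1112 :=
    tracePair_swap hd (r := -1) (s := -1) (t := -1) (u := -2) (m := -2) rfl (by norm_num)
  have pr1112 :=
    tracePairThird_swap hd (r := -1) (s := -1) (t := -1) (u := -2) (m := -3) rfl (by norm_num)
  have fr1121 :=
    traceFour_swap_right hd (r := -1) (s := -1) (t := -2) (u := -1) (m := -3) rfl (by norm_num)
  have fs1121 := traceFour_add_add b d (-1) (-1) (-2) (-1)
  have pr1121 :=
    tracePairThird_swap hd (r := -1) (s := -1) (t := -2) (u := -1) (m := -3) rfl (by norm_num)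
  have fr1211 :=
    traceFour_swap_right hd (r := -1) (s := -2) (t := -1) (u := -1) (m := -2) rfl (by norm_num)
  have fm1211 :=
    traceFour_swap_middle hd (r := -1) (s := -2) (t := -1) (u := -1) (m := -3) rfl (by norm_num)
  have fl1211 :=
    traceFour_swap_left hd (r := -1) (s := -2) (t := -1) (u := -1) (m := -3) rfl (by norm_num)
  have pm1211 :=
    tracePair_swap hd (r := -1) (s := -2) (t := -1) (u := -1) (m := -3) rfl (by norm_num)
  have fr2111 :=
    traceFour_swap_right hd (r := -2) (s := -1) (t := -1) (u := -1) (m := -2) rfl (by norm_num)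
  have five := two_smul_traceFive hd (r := -1) (m := -2) rfl (by norm_num)
  -- Again a solution of the linear system eliminating all reordered quartic and cubic traces; it is
  -- not governed by any closed pattern.
  linear_combination (norm := module) (498 / 5 : ℂ) • c3r113 + (-204 / 5 : ℂ) • c3l113 +
    (132 / 5 : ℂ) • c3l131 + (-396 / 5 : ℂ) • c3r311 + (-438 / 5 : ℂ) • c3r122 +
    (396 / 5 : ℂ) • c3l122 + (264 / 5 : ℂ) • c3r212 + (-132 / 5 : ℂ) • c3l221 +
    (-12 : ℂ) • fr1112 + (6 : ℂ) • fm1112 + (-6 : ℂ) • fl1112 + (6 : ℂ) • fs1112 +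
    (3 / 2 : ℂ) • pm1112 + (3 : ℂ) • pr1112 + (12 : ℂ) • fr1121 + (-12 : ℂ) • fs1121 +
    (-3 / 2 : ℂ) • pr1121 + (1 / 2 : ℂ) • fr1211 + (-12 : ℂ) • fm1211 + (11 : ℂ) • fl1211 +
    (3 / 2 : ℂ) • pm1211 + (-5 : ℂ) • fr2111 + (1 / 2 : ℂ) • five

end SegalSugawara

theorem mainTheorem4 {ι : Type*} [Fintype ι] [DecidableEq ι]
    (b : Module.Basis ι ℂ g2) (d : ι → g2)
    (hd : ∀ i j, g2Form (b i) (d j) = if i = j then 1 else 0) :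
    IsSegalSugawara (matG b d (-1) ^ 3).trace ∧
    IsSegalSugawara ((matG b d (-1) ^ 4).trace + (matG b d (-2) * matG b d (-1) ^ 2).trace) ∧
    IsSegalSugawara ((matG b d (-1) ^ 5).trace + (matG b d (-2) * matG b d (-1) ^ 3).trace) := by
  have h1 := isSegalSugawara_traceTwo hd
  have h2 := isSegalSugawara_traceTwo_derivative hd
  refine ⟨?_, ?_, ?_⟩
  · have e : (matG b d (-1) ^ 3).trace = traceThree b d (-1) (-1) (-1) := by
      rw [traceThree, ← trace_matG_three, pow_three]
    rw [e, traceThree_eq hd]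
    exact h2.smul _
  · have e : (matG b d (-1) ^ 4).trace + (matG b d (-2) * matG b d (-1) ^ 2).trace =
        traceFour b d (-1) (-1) (-1) (-1) + traceThree b d (-2) (-1) (-1) := by
      rw [traceFour, ← trace_matG_four, traceThree, ← trace_matG_three, pow_succ', pow_three, sq]
    rw [e, traceFour_add_eq hd, tracePair_eq]
    exact ((h1.mul h1 (commute_uK_traceTwo _ _ _ _)).smul _).add
      ((isSegalSugawara_traceTwo_second_derivative hd).smul _)
  · have e : (matG b d (-1) ^ 5).trace + (matG b d (-2) * matG b d (-1) ^ 3).trace =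
        traceFive b d (-1) (-1) (-1) (-1) (-1) + traceFour b d (-2) (-1) (-1) (-1) := by
      rw [traceFive, ← trace_matG_five, traceFour, ← trace_matG_four, pow_succ', pow_succ',
        pow_three]
    rw [e, traceFive_add_eq hd, tracePair_eq, tracePair_eq,
      traceTwo_comm hd (r := -2) (s := -1) (by norm_num)]
    exact (((h2.mul h1 (commute_uK_traceTwo _ _ _ _)).smul _).add
      ((h1.mul h2 (commute_uK_traceTwo _ _ _ _)).smul _)).add
      ((isSegalSugawara_traceTwo_third_derivative hd).smul _)
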